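/- Let $\mathfrak g$ be a $6$-dimensional real Lie algebra that is nilpotent of step exactly two, $G$ the connected, simply connected Lie group with Lie algebra $\mathfrak g$, $\Gamma\subset G$ a lattice (a discrete subgroup with compact quotient), and $M=\Gamma\backslash G$ the corresponding nilmanifold. Let $(J,F)$ be an invariant balanced Hermitian structure on $M$: it is induced by an inner product $g$ on $\mathfrak g$ and a $g$-orthogonal endomorphism $J$ of $\mathfrak g$ with $J^2=-1$ and vanishing Nijenhuis tensor, and the fundamental form $F(\cdot,\cdot)=g(\cdot,J\cdot)$ satisfies $dF\wedge F=0$. We say that $(M,J,F)$ is the total space of an (invariant) $\mathbb T^2$-bundle over $\mathbb T^4$ with anti-self-dual curvature if there are a principal $\mathbb T^2$-bundle $\pi\colon M\to\mathbb T^4=\mathbb R^4/\mathbb Z^4$ that is covered by a Lie group homomorphism $G\to\mathbb R^4$ and whose $\mathbb T^2$-action has left-invariant fundamental vector fields, a flat (translation-invariant) Hermitian structure $(g_0,\omega)$ on $\mathbb T^4$, and left-invariant $1$-forms $\eta_1,\eta_2$ on $M$, the components of a connection form with respect to a basis of the Lie algebra of $\mathbb T^2$, such that $$g=\pi^*g_0+\eta_1^2+\eta_2^2,\qquad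 F=\pi^*\omega+\eta_1\wedge\eta_2,\qquad d\eta_i=\pi^*\Omega_i\quad(i=1,2),$$ where $\Omega_1,\Omega_2$ are translation-invariant $2$-forms on $\mathbb T^4$ that are anti-self-dual for $g_0$ and the orientation $\omega\wedge\omega$. Then $(M,J,F)$ is the total space of a $\mathbb T^2$-bundle over $\mathbb T^4$ with anti-self-dual curvature if and only if the complex structure $J$ is Abelian, that is, $[JX,JY]=[X,Y]$ for all $X,Y\in\mathfrak g$. Moreover, in that case $\mathfrak g$ is isomorphic to $\mathfrak h_3$ or to $\mathfrak h_5$, where, in terms of a basis $e^1,\dots,e^6$ of the dual space and with $e^{ij}=e^i\wedge e^j$, the Lie algebra $\mathfrak h_3$ is given by $de^1=\dots=de^5=0$, $de^6=e^{12}+e^{34}$, and $\mathfrak h_5$ by $de^1=\dots=de^4=0$, $de^5=e^{13}-e^{24}$, $de^6=e^{14}+e^{23}$. -/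

import Mathlib

open scoped Nat

noncomputable section

namespace Nilmanifold

/-! ### Two-step nilpotent Lie algebras and their simply connected Lie groups -/

/-- A real Lie algebra that is nilpotent of step exactly two. -/
class IsTwoStepNilpotent (𝔤 : Type*) [LieRing 𝔤] : Prop where
  lie_lie_eq_zero : ∀ x y z : 𝔤, ⁅x, ⁅y, z⁆⁆ = 0
  exists_lie_ne_zero : ∃ x y : 𝔤, ⁅x, y⁆ ≠ 0

/-- The connected, simply connected Lie group `G` with Lie algebra `𝔤`, when `𝔤` is two-step
nilpotent. The exponential map is a diffeomorphism `𝔤 → G`, and an element of `G` is recorded by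
its logarithm; the product is given by the Baker-Campbell-Hausdorff formula
`exp x * exp y = exp (x + y + [x, y] / 2)`. -/
@[ext] structure SimplyConnectedGroup (𝔤 : Type*) where
  exp ::
  log : 𝔤

namespace SimplyConnectedGroup

variable {𝔤 : Type*} [LieRing 𝔤]

instance : One (SimplyConnectedGroup 𝔤) := ⟨exp 0⟩

instance : Inv (SimplyConnectedGroup 𝔤) := ⟨fun a => exp (-a.log)⟩

@[simp] theorem log_one : (1 : SimplyConnectedGroup 𝔤).log = 0 := rfl

@[simp] theorem log_inv (a : SimplyConnectedGroup 𝔤) : (a⁻¹).log = -a.log := rfl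

variable [LieAlgebra ℝ 𝔤]

instance : Mul (SimplyConnectedGroup 𝔤) :=
  ⟨fun a b => exp (a.log + b.log + (2⁻¹ : ℝ) • ⁅a.log, b.log⁆)⟩

@[simp] theorem log_mul (a b : SimplyConnectedGroup 𝔤) :
    (a * b).log = a.log + b.log + (2⁻¹ : ℝ) • ⁅a.log, b.log⁆ := rfl

instance [IsTwoStepNilpotent 𝔤] : Group (SimplyConnectedGroup 𝔤) :=
  Group.ofLeftAxioms
    (fun a b c => by
      have h : ∀ x y z : 𝔤, ⁅⁅x, y⁆, z⁆ = 0 := fun x y z => by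
        rw [← lie_skew, IsTwoStepNilpotent.lie_lie_eq_zero, neg_zero]
      ext
      simp only [log_mul, lie_add, add_lie, smul_lie, lie_smul, h,
        IsTwoStepNilpotent.lie_lie_eq_zero, smul_zero, smul_add, add_zero]
      abel)
    (fun a => by ext; simp)
    (fun a => by ext; simp)

/-- The topology of the group: that of the finite-dimensional real vector space `𝔤`. -/
instance : TopologicalSpace (SimplyConnectedGroup 𝔤) :=
  (moduleTopology ℝ 𝔤).induced log

end SimplyConnectedGroup

open SimplyConnectedGroup

section Quotient

variable {𝔤 : Type*} [LieRing 𝔤] [LieAlgebra ℝ 𝔤] [IsTwoStepNilpotent 𝔤]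

/-- The quotient `M = Γ \ G`, with the quotient topology. Left-invariant tensors on `G`, that is,
tensors on `𝔤`, descend to it. -/
abbrev Space (Γ : Subgroup (SimplyConnectedGroup 𝔤)) : Type _ :=
  Quotient (QuotientGroup.rightRel Γ)

/-- `Γ` is a lattice: a discrete subgroup with compact quotient `Γ \ G`. -/
structure IsLattice (Γ : Subgroup (SimplyConnectedGroup 𝔤)) : Prop where
  discrete : DiscreteTopology Γ
  cocompact : CompactSpace (Space Γ)

end Quotient

/-! ### Invariant forms and Hermitian structures -/

section Linear

variable {V : Type*} [AddCommGroup V] [Module ℝ V]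

/-- The wedge product of a `p`-form and a `q`-form (as functions of their arguments). -/
def wedge {p q : ℕ} (α : (Fin p → V) → ℝ) (β : (Fin q → V) → ℝ) : (Fin (p + q) → V) → ℝ :=
  fun v => ((p ! * q ! : ℕ) : ℝ)⁻¹ * ∑ σ : Equiv.Perm (Fin (p + q)),
    ((Equiv.Perm.sign σ : ℤ) : ℝ) *
      (α (fun i => v (σ (Fin.castAdd q i))) * β (fun j => v (σ (Fin.natAdd p j))))

/-- A bilinear form, as a function of a pair of vectors. -/
def ofBilin (B : LinearMap.BilinForm ℝ V) : (Fin 2 → V) → ℝ := fun v => B (v 0) (v 1)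

/-- A linear Hermitian structure on a real vector space: an inner product `g` and an orthogonal
endomorphism `J` of square `-1`. -/
structure HermitianStructure (V : Type*) [AddCommGroup V] [Module ℝ V] where
  g : LinearMap.BilinForm ℝ V
  J : V →ₗ[ℝ] V
  g_symm : ∀ x y, g x y = g y x
  g_pos : ∀ x, x ≠ 0 → 0 < g x x
  J_sq : ∀ x, J (J x) = -x
  g_J : ∀ x y, g (J x) (J y) = g x y

/-- The fundamental form `F(x, y) = g(x, J y)`. -/
def HermitianStructure.F (S : HermitianStructure V) : LinearMap.BilinForm ℝ V :=
  S.g.compl₂ S.J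

/-- `f` is a `g`-orthonormal family of four vectors, positively oriented for the orientation
given by `F ∧ F`. -/
structure HermitianStructure.IsOrientedOrthonormal (S : HermitianStructure V)
    (f : Fin 4 → V) : Prop where
  orthonormal : ∀ i j, S.g (f i) (f j) = if i = j then 1 else 0
  oriented : 0 < wedge (ofBilin S.F) (ofBilin S.F) f

/-- On a Hermitian vector space of dimension four, `* Ω = - Ω` for a 2-form `Ω`. The Hodge star
of the metric and of the orientation is determined by `(* Ω)(f₀, f₁) = Ω(f₂, f₃)` for every
oriented orthonormal basis `f`. -/
structure HermitianStructure.IsAntiSelfDual (S : HermitianStructure V)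
    (Ω : LinearMap.BilinForm ℝ V) : Prop where
  isAlt : Ω.IsAlt
  star_eq_neg : ∀ f : Fin 4 → V, S.IsOrientedOrthonormal f → Ω (f 2) (f 3) = -Ω (f 0) (f 1)

end Linear

section Invariant

variable {𝔤 : Type*} [LieRing 𝔤] [LieAlgebra ℝ 𝔤]

/-- The exterior derivative of a left-invariant 1-form. -/
def dOne (η : 𝔤 →ₗ[ℝ] ℝ) : 𝔤 → 𝔤 → ℝ := fun x y => -η ⁅x, y⁆

/-- The exterior derivative of a left-invariant 2-form. -/
def dTwo (B : LinearMap.BilinForm ℝ 𝔤) : (Fin 3 → 𝔤) → ℝ := fun v =>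
  -B ⁅v 0, v 1⁆ (v 2) + B ⁅v 0, v 2⁆ (v 1) - B ⁅v 1, v 2⁆ (v 0)

/-- The Nijenhuis tensor of the invariant almost complex structure vanishes. -/
def HermitianStructure.IsIntegrable (S : HermitianStructure 𝔤) : Prop :=
  ∀ x y, ⁅S.J x, S.J y⁆ - S.J ⁅S.J x, y⁆ - S.J ⁅x, S.J y⁆ - ⁅x, y⁆ = 0

/-- In complex dimension three: `dF ∧ F = 0`. -/
def HermitianStructure.IsBalanced (S : HermitianStructure 𝔤) : Prop :=
  wedge (dTwo S.F) (ofBilin S.F) = 0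

/-- The complex structure is Abelian. -/
def HermitianStructure.IsAbelian (S : HermitianStructure 𝔤) : Prop :=
  ∀ x y, ⁅S.J x, S.J y⁆ = ⁅x, y⁆

end Invariant

/-! ### Torus bundles -/

/-- The class in the torus `ℝⁿ / ℤⁿ` of a vector of `ℝⁿ`. -/
def toTorus {n : ℕ} (u : Fin n → ℝ) : UnitAddTorus (Fin n) := fun i => (u i : UnitAddCircle)

/-- `act` is an action of the torus `Tᵐ` on `M` that makes `π : M → B` a principal `Tᵐ`-bundle:
the action preserves the fibres of `π`, and `π` has equivariant local trivializations. -/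
structure IsPrincipalTorusBundle {M B : Type*} [TopologicalSpace M] [TopologicalSpace B] {m : ℕ}
    (act : UnitAddTorus (Fin m) → M → M) (π : M → B) : Prop where
  zero_act : ∀ p, act 0 p = p
  add_act : ∀ s t p, act (s + t) p = act s (act t p)
  proj_act : ∀ s p, π (act s p) = π p
  exists_trivialization : ∀ b : B, ∃ e : Bundle.Trivialization (UnitAddTorus (Fin m)) π,
    b ∈ e.baseSet ∧ ∀ s, ∀ p ∈ e.source, (e (act s p)).2 = s + (e p).2

/-- An invariant structure of `T²`-bundle over `T⁴` with anti-self-dual curvature on the Hermitian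
nilmanifold `(Γ \ G, J, F)`. -/
structure AntiSelfDualTorusBundle {𝔤 : Type*} [LieRing 𝔤] [LieAlgebra ℝ 𝔤] [IsTwoStepNilpotent 𝔤]
    (Γ : Subgroup (SimplyConnectedGroup 𝔤)) (S : HermitianStructure 𝔤) where
  /-- the bundle projection -/
  π : Space Γ → UnitAddTorus (Fin 4)
  /-- the action of the structure group -/
  act : UnitAddTorus (Fin 2) → Space Γ → Space Γ
  isPrincipal : IsPrincipalTorusBundle act π
  /-- the homomorphism of Lie algebras `𝔤 → ℝ⁴` whose integral `G → ℝ⁴` covers `π` -/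
  P : 𝔤 →ₗ[ℝ] (Fin 4 → ℝ)
  P_lie : ∀ x y : 𝔤, P ⁅x, y⁆ = 0
  π_mk : ∀ x : 𝔤, π (Quotient.mk _ (exp x)) = toTorus (P x)
  /-- the (left-invariant) fundamental vector fields of the action; the flow of a left-invariant
  vector field `x` is the right translation by `exp (t x)` -/
  ξ : (Fin 2 → ℝ) →ₗ[ℝ] 𝔤
  act_mk : ∀ (s : Fin 2 → ℝ) (a : SimplyConnectedGroup 𝔤),
    act (toTorus s) (Quotient.mk _ a) = Quotient.mk _ (a * exp (ξ s))
  /-- the flat Hermitian structure of the base `T⁴` -/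
  base : HermitianStructure (Fin 4 → ℝ)
  /-- the connection 1-forms: the components of a connection form with respect to some basis of
  the Lie algebra of the structure group -/
  η : Fin 2 → (𝔤 →ₗ[ℝ] ℝ)
  η_ξ : Function.Bijective fun (s : Fin 2 → ℝ) (i : Fin 2) => η i (ξ s)
  /-- `g = π^* g_base + η₁² + η₂²` -/
  g_eq : ∀ x y, S.g x y = base.g (P x) (P y) + η 0 x * η 0 y + η 1 x * η 1 y
  /-- `F = π^* F_base + η₁ ∧ η₂` -/
  F_eq : ∀ x y, S.F x y = base.F (P x) (P y) + (η 0 x * η 1 y - η 1 x * η 0 y)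
  /-- the curvature 2-forms on `T⁴` -/
  Ω : Fin 2 → LinearMap.BilinForm ℝ (Fin 4 → ℝ)
  dη_eq : ∀ i x y, dOne (η i) x y = Ω i (P x) (P y)
  antiSelfDual : ∀ i, base.IsAntiSelfDual (Ω i)

/-! ### The Lie algebras `𝔥₃` and `𝔥₅` -/

/-- The Lie algebra with `de¹ = ⋯ = de⁵ = 0` and `de⁶ = e¹² + e³⁴`. -/
def H3 : Type := Fin 6 → ℝ

/-- The Lie algebra with `de¹ = ⋯ = de⁴ = 0`, `de⁵ = e¹³ - e²⁴` and `de⁶ = e¹⁴ + e²³`. -/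
def H5 : Type := Fin 6 → ℝ

namespace H3

instance : AddCommGroup H3 := inferInstanceAs (AddCommGroup (Fin 6 → ℝ))

instance : Module ℝ H3 := inferInstanceAs (Module ℝ (Fin 6 → ℝ))

/-- The bracket, determined by `deᵏ(x, y) = -eᵏ([x, y])`. -/
instance : Bracket H3 H3 :=
  ⟨fun x y => ![0, 0, 0, 0, 0, -((x 0 * y 1 - x 1 * y 0) + (x 2 * y 3 - x 3 * y 2))]⟩

theorem add_apply (x y : H3) (i : Fin 6) : (x + y) i = x i + y i := rfl

theorem smul_apply (c : ℝ) (x : H3) (i : Fin 6) : (c • x) i = c * x i := rfl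

theorem zero_apply (i : Fin 6) : (0 : H3) i = 0 := rfl

theorem lie_apply (x y : H3) (i : Fin 6) : ⁅x, y⁆ i =
    ![0, 0, 0, 0, 0, -((x 0 * y 1 - x 1 * y 0) + (x 2 * y 3 - x 3 * y 2))] i := rfl

instance : LieRing H3 where
  add_lie x y z := by
    funext i; fin_cases i <;> simp [lie_apply, add_apply] <;> ring
  lie_add x y z := by
    funext i; fin_cases i <;> simp [lie_apply, add_apply] <;> ring
  lie_self x := by
    funext i; fin_cases i <;> simp [lie_apply, zero_apply] <;> ring
  leibniz_lie x y z := by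
    funext i; fin_cases i <;> simp [lie_apply, add_apply]

instance : LieAlgebra ℝ H3 where
  lie_smul c x y := by
    funext i; fin_cases i <;> simp [lie_apply, smul_apply] <;> ring

end H3

namespace H5

instance : AddCommGroup H5 := inferInstanceAs (AddCommGroup (Fin 6 → ℝ))

instance : Module ℝ H5 := inferInstanceAs (Module ℝ (Fin 6 → ℝ))

/-- The bracket, determined by `deᵏ(x, y) = -eᵏ([x, y])`. -/
instance : Bracket H5 H5 :=
  ⟨fun x y => ![0, 0, 0, 0, -((x 0 * y 2 - x 2 * y 0) - (x 1 * y 3 - x 3 * y 1)),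
    -((x 0 * y 3 - x 3 * y 0) + (x 1 * y 2 - x 2 * y 1))]⟩

theorem add_apply (x y : H5) (i : Fin 6) : (x + y) i = x i + y i := rfl

theorem smul_apply (c : ℝ) (x : H5) (i : Fin 6) : (c • x) i = c * x i := rfl

theorem zero_apply (i : Fin 6) : (0 : H5) i = 0 := rfl

theorem lie_apply (x y : H5) (i : Fin 6) : ⁅x, y⁆ i =
    ![0, 0, 0, 0, -((x 0 * y 2 - x 2 * y 0) - (x 1 * y 3 - x 3 * y 1)),
      -((x 0 * y 3 - x 3 * y 0) + (x 1 * y 2 - x 2 * y 1))] i := rfl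

instance : LieRing H5 where
  add_lie x y z := by
    funext i; fin_cases i <;> simp [lie_apply, add_apply] <;> ring
  lie_add x y z := by
    funext i; fin_cases i <;> simp [lie_apply, add_apply] <;> ring
  lie_self x := by
    funext i; fin_cases i <;> simp [lie_apply, zero_apply] <;> ring
  leibniz_lie x y z := by
    funext i; fin_cases i <;> simp [lie_apply, add_apply]

instance : LieAlgebra ℝ H5 where
  lie_smul c x y := by
    funext i; fin_cases i <;> simp [lie_apply, smul_apply] <;> ring

end H5

end Nilmanifold

end

open scoped Nat

noncomputable section

namespace Nilmanifold

open SimplyConnectedGroup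

/-! ### Wedge products in low degree -/

/-! On a Hermitian space of real dimension four the anti-self-dual 2-forms are exactly the primitive
forms of type (1,1). Abelian means that the bracket is of type (1,1), and balanced makes it
primitive on a complement of the centre; the theorem compares these two statements.

From a bundle to Abelian: `P` together with the two connection forms identifies `𝔤` with `ℝ⁴ × ℝ²`,
and the formulas for `g` and `F` force `P` to intertwine `J` with the complex structure of the base.
Anti-self-dual curvatures are `J`-invariant (`IsAntiSelfDual.map_J`) and `P` kills brackets, so all
components of `[JX, JY]` and `[X, Y]` agree.

From Abelian to a bundle: the centre is `J`-invariant, and the balanced condition makes it a single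
complex line (`exists_central_unit`). The central components of the bracket, restricted to the
orthogonal complement of the centre, are the curvatures, and `isAntiSelfDual_of_primitive` applies
to them. What remains is topological. The image of `Γ` modulo the centre and the intersection of `Γ`
with the centre are both full lattices (`exists_nhds_baseLattice`, `eq_zero_of_fibreLattice`), so
after linear changes of coordinates they become `ℤ⁴` and `ℤ²` (`exists_isIntegral_change`), and `Γ \
G` is a principal torus bundle (`isPrincipalTorusBundle`).

For the Lie algebra: anti-self-dual forms on `ℝ⁴` form a three-dimensional space, so the bracket is
encoded by the linear map `x ↦ [a, x]` from a three-space to the centre, all other brackets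
following from the cross product (`lie_frameVec_frameVec`). Its rank is one or two, which gives `H3`
or `H5` respectively. -/

/-- The alternating sum of a function over all permutations of `Fin n`. -/
def signSum (n : ℕ) (G : (Fin n → Fin n) → ℝ) : ℝ :=
  ∑ σ : Equiv.Perm (Fin n), ((Equiv.Perm.sign σ : ℤ) : ℝ) * G σ

/-- A permutation of `Fin (n + 1)` is determined by the image `p` of `0` and a permutation of the
remaining points, composed with the transposition of `0` and `p`, which is odd unless `p = 0`.
Iterating this turns the sums in `wedge` into explicit expressions. -/
theorem signSum_succ {n : ℕ} (G : (Fin (n + 1) → Fin (n + 1)) → ℝ) :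
    signSum (n + 1) G = ∑ p : Fin (n + 1), (if p = 0 then 1 else -1) *
      signSum n fun s => G (Fin.cons p fun i => Equiv.swap 0 p (s i).succ) := by
  rw [signSum, ← Equiv.Perm.decomposeFin.symm.sum_comp, Fintype.sum_prod_type]
  refine Finset.sum_congr rfl fun p _ => ?_
  rw [signSum, Finset.mul_sum]
  refine Finset.sum_congr rfl fun σ _ => ?_
  have h : (Equiv.Perm.decomposeFin.symm (p, σ) : Fin (n + 1) → Fin (n + 1)) =
      Fin.cons p fun i => Equiv.swap 0 p (σ i).succ := by
    funext i
    refine Fin.cases ?_ (fun i => ?_) i <;> simp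
  rw [h, Equiv.Perm.decomposeFin.symm_sign]
  split_ifs <;> simp

theorem signSum_one (G : (Fin 1 → Fin 1) → ℝ) : signSum 1 G = G id := by
  simp [signSum]

theorem signSum_two (G : (Fin 2 → Fin 2) → ℝ) : signSum 2 G = G ![0, 1] - G ![1, 0] := by
  have h0 : (Fin.cons (0 : Fin 2) fun i : Fin 1 => Equiv.swap 0 (0 : Fin 2) (id i).succ :
      Fin 2 → Fin 2) = ![0, 1] := by decide
  have h1 : (Fin.cons (1 : Fin 2) fun i : Fin 1 => Equiv.swap 0 (1 : Fin 2) (id i).succ :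
      Fin 2 → Fin 2) = ![1, 0] := by decide
  rw [signSum_succ, Fin.sum_univ_two, signSum_one, signSum_one, h0, h1]
  simp [sub_eq_add_neg]

theorem signSum_three (G : (Fin 3 → Fin 3) → ℝ) : signSum 3 G =
    G ![0, 1, 2] - G ![0, 2, 1] - G ![1, 0, 2] + G ![1, 2, 0] - G ![2, 1, 0] + G ![2, 0, 1] := by
  have e : ∀ (p : Fin 3) (s : Fin 2 → Fin 2),
      (Fin.cons p fun i : Fin 2 => Equiv.swap 0 p (s i).succ : Fin 3 → Fin 3) =
        ![p, Equiv.swap 0 p (s 0).succ, Equiv.swap 0 p (s 1).succ] := by decide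
  simp only [signSum_succ (n := 2), signSum_two, e]
  rw [Fin.sum_univ_three]
  have s1 : ∀ i : Fin 3, Equiv.swap 0 1 i = ![1, 0, 2] i := by decide
  have s2 : ∀ i : Fin 3, Equiv.swap 0 2 i = ![2, 1, 0] i := by decide
  simp [s1, s2]
  ring

theorem signSum_four (G : (Fin 4 → Fin 4) → ℝ) : signSum 4 G = ∑ p : Fin 4,
    (if p = 0 then 1 else -1) * signSum 3 fun s =>
      G ![p, Equiv.swap 0 p (s 0).succ, Equiv.swap 0 p (s 1).succ, Equiv.swap 0 p (s 2).succ] := by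
  have e : ∀ (p : Fin 4) (s : Fin 3 → Fin 3),
      (Fin.cons p fun i : Fin 3 => Equiv.swap 0 p (s i).succ : Fin 4 → Fin 4) =
        ![p, Equiv.swap 0 p (s 0).succ, Equiv.swap 0 p (s 1).succ, Equiv.swap 0 p (s 2).succ] := by
    intro p s; funext i; fin_cases i <;> rfl
  simp only [signSum_succ (n := 3), e]

theorem signSum_five (G : (Fin 5 → Fin 5) → ℝ) : signSum 5 G = ∑ p : Fin 5,
    (if p = 0 then 1 else -1) * signSum 4 fun s =>
      G ![p, Equiv.swap 0 p (s 0).succ, Equiv.swap 0 p (s 1).succ, Equiv.swap 0 p (s 2).succ,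
        Equiv.swap 0 p (s 3).succ] := by
  have e : ∀ (p : Fin 5) (s : Fin 4 → Fin 4),
      (Fin.cons p fun i : Fin 4 => Equiv.swap 0 p (s i).succ : Fin 5 → Fin 5) =
        ![p, Equiv.swap 0 p (s 0).succ, Equiv.swap 0 p (s 1).succ, Equiv.swap 0 p (s 2).succ,
        Equiv.swap 0 p (s 3).succ] := by
    intro p s; funext i; fin_cases i <;> rfl
  simp only [signSum_succ (n := 4), e]

variable {V : Type*} [AddCommGroup V] [Module ℝ V]

theorem wedge_two_two {A B : LinearMap.BilinForm ℝ V} (hA : A.IsAlt) (hB : B.IsAlt)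
    (v : Fin 4 → V) :
    wedge (ofBilin A) (ofBilin B) v =
      A (v 0) (v 1) * B (v 2) (v 3) - A (v 0) (v 2) * B (v 1) (v 3)
        + A (v 0) (v 3) * B (v 1) (v 2) + A (v 1) (v 2) * B (v 0) (v 3)
        - A (v 1) (v 3) * B (v 0) (v 2) + A (v 2) (v 3) * B (v 0) (v 1) := by
  have key : wedge (ofBilin A) (ofBilin B) v = ((2 ! * 2 ! : ℕ) : ℝ)⁻¹ *
      signSum 4 fun s => A (v (s 0)) (v (s 1)) * B (v (s 2)) (v (s 3)) := rfl
  have s1 : ∀ i : Fin 4, Equiv.swap 0 1 i = ![1, 0, 2, 3] i := by decide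
  have s2 : ∀ i : Fin 4, Equiv.swap 0 2 i = ![2, 1, 0, 3] i := by decide
  have s3 : ∀ i : Fin 4, Equiv.swap 0 3 i = ![3, 1, 2, 0] i := by decide
  rw [key, signSum_four, Fin.sum_univ_four]
  simp [signSum_three, s1, s2, s3, -Equiv.swap_apply_left]
  rw [← hA.neg_eq (v 0) (v 1), ← hA.neg_eq (v 0) (v 2), ← hA.neg_eq (v 0) (v 3),
    ← hA.neg_eq (v 1) (v 2), ← hA.neg_eq (v 1) (v 3), ← hA.neg_eq (v 2) (v 3),
    ← hB.neg_eq (v 0) (v 1), ← hB.neg_eq (v 0) (v 2), ← hB.neg_eq (v 0) (v 3),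
    ← hB.neg_eq (v 1) (v 2), ← hB.neg_eq (v 1) (v 3), ← hB.neg_eq (v 2) (v 3)]
  ring

theorem HermitianStructure.F_apply (S : HermitianStructure V) (x y : V) :
    S.F x y = S.g x (S.J y) := rfl

theorem HermitianStructure.g_J_left (S : HermitianStructure V) (x y : V) :
    S.g (S.J x) y = -S.g x (S.J y) := by
  rw [← S.g_J x, S.J_sq, map_neg, neg_neg]

theorem HermitianStructure.g_J_right (S : HermitianStructure V) (x y : V) :
    S.g x (S.J y) = -S.g (S.J x) y := by
  rw [S.g_J_left, neg_neg]

theorem HermitianStructure.g_self_J (S : HermitianStructure V) (x : V) :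
    S.g x (S.J x) = 0 := by
  have h := S.g_J_left x x
  rw [S.g_symm] at h
  linarith

theorem HermitianStructure.F_isAlt (S : HermitianStructure V) : S.F.IsAlt := S.g_self_J

theorem HermitianStructure.F_swap (S : HermitianStructure V) (x y : V) : S.F x y = -S.F y x :=
  (S.F_isAlt.neg_eq y x).symm

/-- For an invariant balanced metric, the trace of the bracket with respect to `F` vanishes,
here expressed in terms of four vectors that span a complement of the centre. -/
theorem HermitianStructure.IsBalanced.sum_lie_eq_zero {𝔤 : Type*} [LieRing 𝔤] [LieAlgebra ℝ 𝔤]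
    {S : HermitianStructure 𝔤} (hS : S.IsBalanced) {f : Fin 4 → 𝔤} {x : 𝔤}
    (hx : ∀ i, ⁅f i, x⁆ = 0) (hfx : ∀ i, S.F (f i) x = 0)
    (hlie : ∀ i j k, S.F ⁅f i, f j⁆ (f k) = 0) :
    S.F ⁅f 0, f 1⁆ x * S.F (f 2) (f 3) - S.F ⁅f 0, f 2⁆ x * S.F (f 1) (f 3)
      + S.F ⁅f 0, f 3⁆ x * S.F (f 1) (f 2) + S.F ⁅f 1, f 2⁆ x * S.F (f 0) (f 3)
      - S.F ⁅f 1, f 3⁆ x * S.F (f 0) (f 2) + S.F ⁅f 2, f 3⁆ x * S.F (f 0) (f 1) = 0 := by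
  -- With `x` central and `F`-orthogonal to the `f i`, the only surviving terms of the 5-form are
  -- those where `dF` takes `x` and two of the `f i`, and `F` takes the other two.
  have h0 : wedge (dTwo S.F) (ofBilin S.F) ![f 0, f 1, f 2, f 3, x] = 0 := by
    rw [show wedge (dTwo S.F) (ofBilin S.F) = 0 from hS]; rfl
  have key : ∀ v : Fin 5 → 𝔤, wedge (dTwo S.F) (ofBilin S.F) v = ((3 ! * 2 ! : ℕ) : ℝ)⁻¹ *
      signSum 5 fun s => (-S.F ⁅v (s 0), v (s 1)⁆ (v (s 2)) + S.F ⁅v (s 0), v (s 2)⁆ (v (s 1))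
        - S.F ⁅v (s 1), v (s 2)⁆ (v (s 0))) * S.F (v (s 3)) (v (s 4)) := fun _ => rfl
  have hx' : ∀ i, ⁅x, f i⁆ = 0 := fun i => by rw [← lie_skew, hx, neg_zero]
  have hfx' : ∀ i, S.F x (f i) = 0 := fun i => by rw [S.F_swap, hfx, neg_zero]
  have s1 : ∀ i : Fin 4, Equiv.swap 0 1 i = ![1, 0, 2, 3] i := by decide
  have s2 : ∀ i : Fin 4, Equiv.swap 0 2 i = ![2, 1, 0, 3] i := by decide
  have s3 : ∀ i : Fin 4, Equiv.swap 0 3 i = ![3, 1, 2, 0] i := by decide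
  have t1 : ∀ i : Fin 5, Equiv.swap 0 1 i = ![1, 0, 2, 3, 4] i := by decide
  have t2 : ∀ i : Fin 5, Equiv.swap 0 2 i = ![2, 1, 0, 3, 4] i := by decide
  have t3 : ∀ i : Fin 5, Equiv.swap 0 3 i = ![3, 1, 2, 0, 4] i := by decide
  have t4 : ∀ i : Fin 5, Equiv.swap 0 4 i = ![4, 1, 2, 3, 0] i := by decide
  rw [key, signSum_five, Fin.sum_univ_five] at h0
  simp [signSum_four, Fin.sum_univ_four, signSum_three, s1, s2, s3, t1, t2, t3, t4, hx, hx', hfx,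
    hfx', hlie, -Equiv.swap_apply_left] at h0
  have b : ∀ i j, S.F ⁅f i, f j⁆ x = - S.F ⁅f j, f i⁆ x := fun i j => by
    rw [← lie_skew, map_neg, LinearMap.neg_apply]
  have c : ∀ i j, S.F (f i) (f j) = -S.F (f j) (f i) := fun i j => S.F_swap _ _
  rw [b 1 0, b 2 0, b 3 0, b 2 1, b 3 1, b 3 2, c 1 0, c 2 0, c 3 0, c 2 1, c 3 1, c 3 2] at h0
  rcases h0 with h0 | h0
  · exact absurd h0 (Nat.factorial_ne_zero 3)
  · linarith

/-! ### Linear algebra of Hermitian structures -/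

namespace HermitianStructure

variable {V : Type*} [AddCommGroup V] [Module ℝ V] (S : HermitianStructure V)

theorem exists_smul_unit {x : V} (hx : x ≠ 0) : ∃ c : ℝ, c ≠ 0 ∧ S.g (c • x) (c • x) = 1 := by
  have h := S.g_pos x hx
  have h' : √(S.g x x) ≠ 0 := (Real.sqrt_pos.2 h).ne'
  refine ⟨(√(S.g x x))⁻¹, inv_ne_zero h', ?_⟩
  have h2 := Real.mul_self_sqrt h.le
  simp only [map_smul, LinearMap.smul_apply, smul_eq_mul]
  rw [← mul_assoc, ← mul_inv, h2, inv_mul_cancel₀ h.ne']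

theorem exists_unit_orthogonal [Module.Finite ℝ V] {n : ℕ} (hn : n < Module.finrank ℝ V)
    (f : Fin n → V) : ∃ u, S.g u u = 1 ∧ ∀ i, S.g (f i) u = 0 := by
  have hker := LinearMap.ker_ne_bot_of_finrank_lt (f := LinearMap.pi fun i => S.g (f i))
    (by simpa using hn)
  obtain ⟨x, hx, hx0⟩ := Submodule.exists_mem_ne_zero_of_ne_bot hker
  obtain ⟨c, -, hc⟩ := S.exists_smul_unit hx0
  refine ⟨c • x, hc, fun i => ?_⟩
  have := congrFun (LinearMap.mem_ker.1 hx) i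
  simp only [LinearMap.pi_apply, Pi.zero_apply] at this
  simp [this]

/-- The coordinate map `x ↦ (g (f i) x)` is onto by orthonormality, hence injective for reasons of
dimension. -/
theorem eq_sum_of_orthonormal [Module.Finite ℝ V] {n : ℕ} (hn : Module.finrank ℝ V = n)
    {f : Fin n → V} (hf : ∀ i j, S.g (f i) (f j) = if i = j then 1 else 0) (x : V) :
    x = ∑ i, S.g (f i) x • f i := by
  have hsum : ∀ (c : Fin n → ℝ) i, S.g (f i) (∑ j, c j • f j) = c i := fun c i => by
    simp [hf]
  have hsurj : Function.Surjective (LinearMap.pi fun i => S.g (f i)) := fun c =>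
    ⟨∑ j, c j • f j, funext fun i => by simp [hf]⟩
  have hinj := (LinearMap.injective_iff_surjective_of_finrank_eq_finrank (by simpa using hn)).2
    hsurj
  refine hinj (funext fun i => ?_)
  simp only [LinearMap.pi_apply, hsum]

/-- A triple of unit vectors that are orthogonal to each other for the Hermitian product. -/
structure IsUnitaryTriple (a b c : V) : Prop where
  aa : S.g a a = 1
  bb : S.g b b = 1
  cc : S.g c c = 1
  ca : S.g c a = 0
  cb : S.g c b = 0
  ab : S.g a b = 0
  Jca : S.g (S.J c) a = 0
  Jcb : S.g (S.J c) b = 0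
  Jab : S.g (S.J a) b = 0

namespace IsUnitaryTriple

variable {S} {a b c : V}

theorem g_J_eq (h : S.IsUnitaryTriple a b c) :
    S.g c (S.J a) = 0 ∧ S.g c (S.J b) = 0 ∧ S.g a (S.J b) = 0 := by
  simp [S.g_J_right, h.Jca, h.Jcb, h.Jab]

theorem orthonormal (h : S.IsUnitaryTriple a b c) (i j : Fin 6) :
    S.g (![a, S.J a, b, S.J b, c, S.J c] i) (![a, S.J a, b, S.J b, c, S.J c] j) =
      if i = j then 1 else 0 := by
  obtain ⟨h1, h2, h3⟩ := h.g_J_eq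
  have k1 := h.ca
  have k2 := h.cb
  have k3 := h.ab
  have k4 := h.Jca
  have k5 := h.Jcb
  have k6 := h.Jab
  rw [S.g_symm] at h1 h2 h3 k1 k2 k3 k4 k5 k6
  fin_cases i <;> fin_cases j <;>
    simp [S.g_J, h.aa, h.bb, h.cc, h.ca, h.cb, h.ab, h.Jca, h.Jcb, h.Jab, h.g_J_eq, h1, h2, h3,
      k1, k2, k3, k4, k5, k6, S.g_self_J, S.g_J_left]

theorem eq_sum (h : S.IsUnitaryTriple a b c) (hdim : Module.finrank ℝ V = 6) (x : V) :
    x = S.g a x • a + S.g (S.J a) x • S.J a + S.g b x • b + S.g (S.J b) x • S.J b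
      + S.g c x • c + S.g (S.J c) x • S.J c := by
  have : Module.Finite ℝ V := Module.finite_of_finrank_pos (by omega)
  have := S.eq_sum_of_orthonormal hdim h.orthonormal x
  simpa [Fin.sum_univ_six] using this

end IsUnitaryTriple

/-- The order `u, w, J w, J u` is chosen so that anti-self-duality on this frame reads `Ω (J w) (J
u) = -Ω u w`, which is `J`-invariance. -/
theorem isOrientedOrthonormal_unitary {u w : V} (hu : S.g u u = 1) (hw : S.g w w = 1)
    (huw : S.g u w = 0) (hJ : S.g u (S.J w) = 0) :
    S.IsOrientedOrthonormal ![u, w, S.J w, S.J u] := by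
  have k1 : S.g w u = 0 := by rw [S.g_symm, huw]
  have k2 : S.g w (S.J u) = 0 := by rw [S.g_J_right, S.g_symm, hJ, neg_zero]
  refine ⟨fun i j => ?_, ?_⟩
  · fin_cases i <;> fin_cases j <;>
      simp [S.g_J, hu, hw, huw, hJ, k1, k2, S.g_self_J, S.g_J_left]
  · rw [wedge_two_two S.F_isAlt S.F_isAlt]
    simp [F_apply, S.J_sq, hu, hw, huw, hJ, k1]

-- Unitary frames give the claim for Hermitian-orthogonal pairs. In general, split `v` into its
-- component in the complex line of `u` and a Hermitian-orthogonal rest; on a complex line every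
-- 2-form is `J`-invariant.
variable {S} in
theorem IsAntiSelfDual.map_J {Ω : LinearMap.BilinForm ℝ V} (h : S.IsAntiSelfDual Ω) (u v : V) :
    Ω (S.J u) (S.J v) = Ω u v := by
  have hunit : ∀ u w, S.g u u = 1 → S.g w w = 1 → S.g u w = 0 → S.g u (S.J w) = 0 →
      Ω (S.J u) (S.J w) = Ω u w := fun u w hu hw huw hJ => by
    have := h.star_eq_neg _ (S.isOrientedOrthonormal_unitary hu hw huw hJ)
    simp only [Matrix.cons_val] at this
    rw [← h.isAlt.neg_eq, this, neg_neg]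
  have hort : ∀ u w, S.g u w = 0 → S.g u (S.J w) = 0 → Ω (S.J u) (S.J w) = Ω u w := by
    intro u w huw hJ
    by_cases hu : u = 0
    · simp [hu]
    by_cases hw : w = 0
    · simp [hw]
    obtain ⟨s, hs, hs1⟩ := S.exists_smul_unit hu
    obtain ⟨t, ht, ht1⟩ := S.exists_smul_unit hw
    have := hunit (s • u) (t • w) hs1 ht1 (by simp [huw]) (by simp [hJ])
    simpa [hs, ht] using this
  by_cases hu : u = 0
  · simp [hu]
  have hpos := (S.g_pos u hu).ne'
  obtain ⟨α, β, w, hw, h1, h2⟩ : ∃ (α β : ℝ) (w : V), v = α • u + β • S.J u + w ∧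
      S.g u w = 0 ∧ S.g u (S.J w) = 0 := by
    refine ⟨S.g u v / S.g u u, S.g (S.J u) v / S.g u u, v - (S.g u v / S.g u u) • u -
      (S.g (S.J u) v / S.g u u) • S.J u, by abel, ?_, ?_⟩
    · simp [S.g_self_J, hpos]
    · simp [S.g_self_J, hpos, S.J_sq, S.g_J_left]
  have h3 := hort u w h1 h2
  have h4 : Ω (S.J u) u = -Ω u (S.J u) := (h.isAlt.neg_eq _ _).symm
  rw [hw]
  simp [h3, h4, h.isAlt.self_eq_zero, S.J_sq]

/-- On a Hermitian vector space of dimension four, primitive `(1, 1)`-forms are anti-self-dual. -/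
theorem isAntiSelfDual_of_primitive (hdim : Module.finrank ℝ V = 4)
    {Ω : LinearMap.BilinForm ℝ V} (hΩ : Ω.IsAlt) (hJ : ∀ u v, Ω (S.J u) (S.J v) = Ω u v)
    (hprim : wedge (ofBilin Ω) (ofBilin S.F) = 0) : S.IsAntiSelfDual Ω := by
  have : Module.Finite ℝ V := Module.finite_of_finrank_pos (by omega)
  refine ⟨hΩ, fun f hf => ?_⟩
  have hp : wedge (ofBilin Ω) (ofBilin S.F) f = 0 := by rw [hprim]; rfl
  have ho := hf.oriented
  rw [wedge_two_two hΩ S.F_isAlt] at hp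
  rw [wedge_two_two S.F_isAlt S.F_isAlt] at ho
  have hexp : ∀ j, S.J (f j) = ∑ i, S.F (f i) (f j) • f i := fun j =>
    S.eq_sum_of_orthonormal hdim hf.orthonormal _
  -- The matrix of `F` in an orthonormal basis is skew and orthogonal.
  have hrel : ∀ i j, ∑ k, S.F (f k) (f i) * S.F (f k) (f j) = if i = j then 1 else 0 := by
    intro i j
    rw [← hf.orthonormal i j, ← S.g_J (f i) (f j), hexp i]
    simp [F_apply]
  have c : ∀ i, S.F (f i) (f i) = 0 := fun i => S.F_isAlt.self_eq_zero _
  have d : ∀ i, Ω (f i) (f i) = 0 := fun i => hΩ.self_eq_zero _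
  have r00 := hrel 0 0
  have r11 := hrel 1 1
  have r22 := hrel 2 2
  have r33 := hrel 3 3
  have r01 := hrel 0 1
  have r02 := hrel 0 2
  have r03 := hrel 0 3
  have r12 := hrel 1 2
  have r13 := hrel 1 3
  have r23 := hrel 2 3
  have key := hJ (f 0) (f 1)
  rw [hexp 0, hexp 1] at key
  simp only [Fin.sum_univ_four, map_add, map_smul, LinearMap.add_apply, LinearMap.smul_apply,
    smul_eq_mul, c, d, S.F_swap (f 1) (f 0), S.F_swap (f 2) (f 0), S.F_swap (f 3) (f 0),
    S.F_swap (f 2) (f 1), S.F_swap (f 3) (f 1), S.F_swap (f 3) (f 2),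
    ← hΩ.neg_eq (f 0) (f 1), ← hΩ.neg_eq (f 0) (f 2), ← hΩ.neg_eq (f 0) (f 3),
    ← hΩ.neg_eq (f 1) (f 2), ← hΩ.neg_eq (f 1) (f 3), ← hΩ.neg_eq (f 2) (f 3)]
    at r00 r11 r22 r33 r01 r02 r03 r12 r13 r23 key
  simp only [Fin.reduceEq, if_true, if_false] at r00 r11 r22 r33 r01 r02 r03 r12 r13 r23
  generalize S.F (f 0) (f 1) = F01 at *
  generalize S.F (f 0) (f 2) = F02 at *
  generalize S.F (f 0) (f 3) = F03 at *
  generalize S.F (f 1) (f 2) = F12 at *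
  generalize S.F (f 1) (f 3) = F13 at *
  generalize S.F (f 2) (f 3) = F23 at *
  generalize Ω (f 0) (f 1) = W01 at *
  generalize Ω (f 0) (f 2) = W02 at *
  generalize Ω (f 0) (f 3) = W03 at *
  generalize Ω (f 1) (f 2) = W12 at *
  generalize Ω (f 1) (f 3) = W13 at *
  generalize Ω (f 2) (f 3) = W23 at *
  -- For a skew orthogonal 4×4 matrix, the Pfaffian times the matrix is its Hodge dual, so the
  -- Pfaffian is ±1. The orientation makes it 1, and `F` is self-dual.
  obtain ⟨pf, hpf⟩ : ∃ pf, pf = F01 * F23 - F02 * F13 + F03 * F12 := ⟨_, rfl⟩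
  have e1 : pf * F01 = F23 := by rw [hpf]; linear_combination F23 * r00 + F02 * r03 - F03 * r02
  have e2 : pf * F02 = -F13 := by rw [hpf]; linear_combination -F13 * r00 - F01 * r03 + F03 * r01
  have e3 : pf * F03 = F12 := by rw [hpf]; linear_combination F12 * r00 + F01 * r02 - F02 * r01
  have e4 : pf ^ 2 = 1 := by
    have : F12 ^ 2 + F13 ^ 2 + F23 ^ 2 = 1 := by linarith
    rw [sq]; nth_rewrite 2 [hpf]
    linear_combination F23 * e1 - F13 * e2 + F12 * e3 + this
  have e5 : pf = 1 := by
    have : 0 < pf := by linarith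
    nlinarith
  subst e5
  obtain rfl : F23 = F01 := by linarith
  obtain rfl : F12 = F03 := by linarith
  obtain rfl : F13 = -F02 := by linarith
  linear_combination (-key) + (F23 * hp) - W23 * r00

end HermitianStructure

/-! ### Abelian balanced structures -/

theorem lie_lie_left_eq_zero {𝔤 : Type*} [LieRing 𝔤] [IsTwoStepNilpotent 𝔤] (x y z : 𝔤) :
    ⁅⁅x, y⁆, z⁆ = 0 := by
  rw [← lie_skew, IsTwoStepNilpotent.lie_lie_eq_zero, neg_zero]

namespace HermitianStructure

variable {𝔤 : Type*} [LieRing 𝔤] [LieAlgebra ℝ 𝔤] {S : HermitianStructure 𝔤}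

theorem IsAbelian.lie_J_left (hab : S.IsAbelian) (x y : 𝔤) : ⁅S.J x, y⁆ = -⁅x, S.J y⁆ := by
  rw [← hab x, S.J_sq, lie_neg, neg_neg]

theorem IsAbelian.lie_J_eq_zero (hab : S.IsAbelian) {x : 𝔤} (hx : ∀ y : 𝔤, ⁅x, y⁆ = 0) (y : 𝔤) :
    ⁅S.J x, y⁆ = 0 := by
  rw [hab.lie_J_left, hx, neg_zero]

/-- A unitary basis `a, J a, b, J b, c, J c` of `𝔤` such that `c, J c` is a basis of the centre,
and the centre contains the brackets. -/
structure IsAdaptedTriple (S : HermitianStructure 𝔤) (a b c : 𝔤) : Prop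
    extends S.IsUnitaryTriple a b c where
  lie_c : ∀ y : 𝔤, ⁅c, y⁆ = 0
  lie_Jc : ∀ y : 𝔤, ⁅S.J c, y⁆ = 0
  lie_lie : ∀ x y z : 𝔤, ⁅⁅x, y⁆, z⁆ = 0
  eq_of_central : ∀ x : 𝔤, (∀ y : 𝔤, ⁅x, y⁆ = 0) → x = S.g c x • c + S.g (S.J c) x • S.J c

/-- The centre is a complex line. -/
theorem exists_central_unit [IsTwoStepNilpotent 𝔤] (hdim : Module.finrank ℝ 𝔤 = 6)
    (hab : S.IsAbelian) (hF : S.IsBalanced) :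
    ∃ c, S.g c c = 1 ∧ (∀ y : 𝔤, ⁅c, y⁆ = 0) ∧
      ∀ x : 𝔤, (∀ y : 𝔤, ⁅x, y⁆ = 0) → x = S.g c x • c + S.g (S.J c) x • S.J c := by
  have : Module.Finite ℝ 𝔤 := Module.finite_of_finrank_pos (by omega)
  obtain ⟨x₀, y₀, h₀⟩ := IsTwoStepNilpotent.exists_lie_ne_zero (𝔤 := 𝔤)
  obtain ⟨t, ht, hc⟩ := S.exists_smul_unit h₀
  obtain ⟨c, hcdef⟩ : ∃ c, c = t • ⁅x₀, y₀⁆ := ⟨_, rfl⟩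
  rw [← hcdef] at hc
  have hcz : ∀ y : 𝔤, ⁅c, y⁆ = 0 := fun y => by
    rw [hcdef, smul_lie, lie_lie_left_eq_zero, smul_zero]
  refine ⟨c, hc, hcz, fun x hx => ?_⟩
  -- A further central direction `a` makes the centre contain a complex plane, so that only one
  -- complex line, spanned by `b`, is left on which the bracket can live.
  by_contra hne
  have hJcz := hab.lie_J_eq_zero hcz
  obtain ⟨d, hd⟩ : ∃ d, d = x - S.g c x • c - S.g (S.J c) x • S.J c := ⟨_, rfl⟩
  have hd0 : d ≠ 0 := fun h => hne (by
    rw [hd, sub_sub, sub_eq_zero] at h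
    exact h)
  have hdz : ∀ y : 𝔤, ⁅d, y⁆ = 0 := fun y => by simp [hd, hx, hcz, hJcz]
  obtain ⟨s, hs, ha⟩ := S.exists_smul_unit hd0
  obtain ⟨a, hadef⟩ : ∃ a, a = s • d := ⟨_, rfl⟩
  rw [← hadef] at ha
  have haz : ∀ y : 𝔤, ⁅a, y⁆ = 0 := fun y => by rw [hadef, smul_lie, hdz, smul_zero]
  have hJaz := hab.lie_J_eq_zero haz
  have hca : S.g c a = 0 := by simp [hadef, hd, hc, S.g_self_J]
  have hJca : S.g (S.J c) a = 0 := by simp [hadef, hd, hc, S.g_J_left, S.g_self_J, S.J_sq]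
  obtain ⟨b, hb, hort⟩ := S.exists_unit_orthogonal (n := 4) (by omega) ![c, S.J c, a, S.J a]
  have T : S.IsUnitaryTriple a b c :=
    ⟨ha, hb, hc, hca, hort 0, hort 2, hJca, hort 1, hort 3⟩
  have hlie : ∀ y y' : 𝔤, ∃ k : ℝ, ⁅y, y'⁆ = k • ⁅b, S.J b⁆ := by
    intro y y'
    have flip : ∀ {u : 𝔤}, (∀ y : 𝔤, ⁅u, y⁆ = 0) → ∀ y : 𝔤, ⁅y, u⁆ = 0 := fun h y => by
      rw [← lie_skew, h, neg_zero]
    refine ⟨S.g b y * S.g (S.J b) y' - S.g (S.J b) y * S.g b y', ?_⟩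
    conv_lhs => rw [T.eq_sum hdim y, T.eq_sum hdim y']
    simp only [add_lie, lie_add, smul_lie, lie_smul, haz, hJaz, hcz, hJcz, flip haz, flip hJaz,
      flip hcz, flip hJcz, lie_self, hab.lie_J_left b b]
    module
  obtain ⟨k, hk⟩ := hlie x₀ y₀
  have hk0 : k ≠ 0 := fun h => h₀ (by rw [hk, h, zero_smul])
  have hw : ⁅b, S.J b⁆ = (t⁻¹ * k⁻¹) • c := by
    rw [hcdef, hk, smul_smul, smul_smul, show t⁻¹ * k⁻¹ * t * k = 1 by field_simp, one_smul]
  have hort : ∀ i, S.g c (S.J (![a, S.J a, b, S.J b] i)) = 0 := by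
    intro i
    fin_cases i <;> simp [T.g_J_eq, T.ca, T.cb, S.J_sq]
  -- The test vector is `J c` because `F c c = 0` while `F c (J c) = -1`. Only the term pairing `F a
  -- (J a)` with `⁅b, J b⁆` survives, and it is nonzero.
  have hbal := hF.sum_lie_eq_zero (f := ![a, S.J a, b, S.J b]) (x := S.J c)
    (fun i => by rw [← lie_skew, hJcz, neg_zero])
    (fun i => by
      rw [F_apply, S.J_sq, map_neg, S.g_symm]
      fin_cases i <;> simp [T.g_J_eq, T.ca, T.cb])
    (fun i j l => by
      obtain ⟨m, hm⟩ := hlie (![a, S.J a, b, S.J b] i) (![a, S.J a, b, S.J b] j)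
      rw [hm, hw, F_apply]
      simp only [map_smul, LinearMap.smul_apply, hort, smul_zero])
  simp [haz, hJaz, hw, F_apply, S.J_sq, hc, ha, ht, hk0] at hbal

namespace IsAdaptedTriple

variable {a b c : 𝔤}

theorem lie_eq (h : S.IsAdaptedTriple a b c) (x y : 𝔤) :
    ⁅x, y⁆ = S.g c ⁅x, y⁆ • c + S.g (S.J c) ⁅x, y⁆ • S.J c :=
  h.eq_of_central _ (h.lie_lie x y)

theorem lie_right (h : S.IsAdaptedTriple a b c) (y : 𝔤) : ⁅y, c⁆ = 0 := by
  rw [← lie_skew, h.lie_c, neg_zero]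

theorem lie_J_right (h : S.IsAdaptedTriple a b c) (y : 𝔤) : ⁅y, S.J c⁆ = 0 := by
  rw [← lie_skew, h.lie_Jc, neg_zero]

/-- The components of the bracket are primitive on the orthogonal complement of the centre. -/
theorem sum_lie_eq_zero (h : S.IsAdaptedTriple a b c) (hF : S.IsBalanced) {f : Fin 4 → 𝔤}
    (hf : ∀ i, S.g c (f i) = 0) (hf' : ∀ i, S.g (S.J c) (f i) = 0) :
    S.F (f 2) (f 3) • ⁅f 0, f 1⁆ - S.F (f 1) (f 3) • ⁅f 0, f 2⁆ + S.F (f 1) (f 2) • ⁅f 0, f 3⁆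
      + S.F (f 0) (f 3) • ⁅f 1, f 2⁆ - S.F (f 0) (f 2) • ⁅f 1, f 3⁆
      + S.F (f 0) (f 1) • ⁅f 2, f 3⁆ = 0 := by
  have hlie : ∀ i j k, S.F ⁅f i, f j⁆ (f k) = 0 := fun i j k => by
    rw [h.lie_eq, F_apply]
    simp [S.g_J, S.g_J_right c, hf, hf']
  have h1 := hF.sum_lie_eq_zero (x := c) (fun i => h.lie_right _)
    (fun i => by rw [F_apply, S.g_symm, hf']) hlie
  have h2 := hF.sum_lie_eq_zero (x := S.J c) (fun i => h.lie_J_right _)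
    (fun i => by rw [F_apply, S.J_sq, map_neg, S.g_symm, hf, neg_zero]) hlie
  have e1 : ∀ x, S.F x c = S.g (S.J c) x := fun x => S.g_symm _ _
  have e2 : ∀ x, S.F x (S.J c) = -S.g c x := fun x => by
    rw [F_apply, S.J_sq, map_neg, S.g_symm]
  simp only [e1] at h1
  simp only [e2] at h2
  rw [h.lie_eq (f 0) (f 1), h.lie_eq (f 0) (f 2), h.lie_eq (f 0) (f 3), h.lie_eq (f 1) (f 2),
    h.lie_eq (f 1) (f 3), h.lie_eq (f 2) (f 3)]
  linear_combination (norm := module) (-h2) • c + h1 • S.J c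

end IsAdaptedTriple

theorem exists_isAdaptedTriple [IsTwoStepNilpotent 𝔤] (hdim : Module.finrank ℝ 𝔤 = 6)
    (hab : S.IsAbelian) (hF : S.IsBalanced) : ∃ a b c, S.IsAdaptedTriple a b c := by
  have : Module.Finite ℝ 𝔤 := Module.finite_of_finrank_pos (by omega)
  obtain ⟨c, hc, hcz, hcen⟩ := exists_central_unit hdim hab hF
  obtain ⟨a, ha, hort⟩ := S.exists_unit_orthogonal (n := 2) (by omega) ![c, S.J c]
  obtain ⟨b, hb, hort'⟩ := S.exists_unit_orthogonal (n := 4) (by omega) ![c, S.J c, a, S.J a]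
  exact ⟨a, b, c, ⟨ha, hb, hc, hort 0, hort' 0, hort' 2, hort 1, hort' 1, hort' 3⟩, hcz,
    hab.lie_J_eq_zero hcz, lie_lie_left_eq_zero, hcen⟩

end HermitianStructure

/-! ### Identification of the Lie algebra -/

section Classification

variable {𝔤 : Type*} [LieRing 𝔤] [LieAlgebra ℝ 𝔤]

theorem bijective_sum_smul (hdim : Module.finrank ℝ 𝔤 = 6) {v : Fin 6 → 𝔤}
    (hv : LinearIndependent ℝ v) : Function.Bijective fun x : Fin 6 → ℝ => ∑ i, x i • v i := by
  have : Module.Finite ℝ 𝔤 := Module.finite_of_finrank_pos (by omega)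
  have hinj : Function.Injective (Fintype.linearCombination ℝ v) :=
    by
    rw [Fintype.linearIndependent_iff] at hv
    refine (injective_iff_map_eq_zero _).2 fun x hx => funext (hv x ?_)
    simpa [Fintype.linearCombination_apply] using hx
  exact ⟨hinj, (LinearMap.injective_iff_surjective_of_finrank_eq_finrank (by simp [hdim])).1 hinj⟩

theorem nonempty_lieEquiv_H3 (hdim : Module.finrank ℝ 𝔤 = 6) {v : Fin 6 → 𝔤}
    (hv : LinearIndependent ℝ v) (h4 : ∀ y : 𝔤, ⁅v 4, y⁆ = 0) (h5 : ∀ y : 𝔤, ⁅v 5, y⁆ = 0)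
    (h01 : ⁅v 0, v 1⁆ = -v 5) (h23 : ⁅v 2, v 3⁆ = -v 5) (h02 : ⁅v 0, v 2⁆ = 0)
    (h03 : ⁅v 0, v 3⁆ = 0) (h12 : ⁅v 1, v 2⁆ = 0) (h13 : ⁅v 1, v 3⁆ = 0) :
    Nonempty (𝔤 ≃ₗ⁅ℝ⁆ H3) := by
  have hneg : ∀ i j, ⁅v i, v j⁆ = -⁅v j, v i⁆ := fun i j => (lie_skew _ _).symm
  have h4' : ∀ y : 𝔤, ⁅y, v 4⁆ = 0 := fun y => by rw [← lie_skew, h4, neg_zero]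
  have h5' : ∀ y : 𝔤, ⁅y, v 5⁆ = 0 := fun y => by rw [← lie_skew, h5, neg_zero]
  let T : H3 →ₗ⁅ℝ⁆ 𝔤 :=
    { toFun := fun x => ∑ i, x i • v i
      map_add' := fun x y => by
        simp only [H3.add_apply, add_smul, Finset.sum_add_distrib]
      map_smul' := fun r x => by
        simp only [H3.smul_apply, mul_smul, Finset.smul_sum, RingHom.id_apply]
      map_lie' := fun {x y} => by
        simp only [Fin.sum_univ_six, H3.lie_apply, Matrix.cons_val, add_lie, lie_add, smul_lie,
          lie_smul, lie_self, h4, h5, h4', h5', hneg 1 0, hneg 2 0, hneg 3 0, hneg 2 1,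
          hneg 3 1, hneg 3 2, h01, h23, h02, h03, h12, h13]
        module }
  exact ⟨(LieEquiv.ofBijective T (bijective_sum_smul hdim hv)).symm⟩

theorem nonempty_lieEquiv_H5 (hdim : Module.finrank ℝ 𝔤 = 6) {v : Fin 6 → 𝔤}
    (hv : LinearIndependent ℝ v) (h4 : ∀ y : 𝔤, ⁅v 4, y⁆ = 0) (h5 : ∀ y : 𝔤, ⁅v 5, y⁆ = 0)
    (h01 : ⁅v 0, v 1⁆ = 0) (h23 : ⁅v 2, v 3⁆ = 0) (h02 : ⁅v 0, v 2⁆ = -v 4)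
    (h13 : ⁅v 1, v 3⁆ = v 4) (h03 : ⁅v 0, v 3⁆ = -v 5) (h12 : ⁅v 1, v 2⁆ = -v 5) :
    Nonempty (𝔤 ≃ₗ⁅ℝ⁆ H5) := by
  have hneg : ∀ i j, ⁅v i, v j⁆ = -⁅v j, v i⁆ := fun i j => (lie_skew _ _).symm
  have h4' : ∀ y : 𝔤, ⁅y, v 4⁆ = 0 := fun y => by rw [← lie_skew, h4, neg_zero]
  have h5' : ∀ y : 𝔤, ⁅y, v 5⁆ = 0 := fun y => by rw [← lie_skew, h5, neg_zero]
  let T : H5 →ₗ⁅ℝ⁆ 𝔤 :=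
    { toFun := fun x => ∑ i, x i • v i
      map_add' := fun x y => by
        simp only [H5.add_apply, add_smul, Finset.sum_add_distrib]
      map_smul' := fun r x => by
        simp only [H5.smul_apply, mul_smul, Finset.smul_sum, RingHom.id_apply]
      map_lie' := fun {x y} => by
        simp only [Fin.sum_univ_six, H5.lie_apply, Matrix.cons_val, add_lie, lie_add, smul_lie,
          lie_smul, lie_self, h4, h5, h4', h5', hneg 1 0, hneg 2 0, hneg 3 0, hneg 2 1,
          hneg 3 1, hneg 3 2, h01, h23, h02, h03, h12, h13]
        module }
  exact ⟨(LieEquiv.ofBijective T (bijective_sum_smul hdim hv)).symm⟩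

theorem exists_unit_mem_ker (L : (Fin 3 → ℝ) →ₗ[ℝ] Fin 2 → ℝ) :
    ∃ n : Fin 3 → ℝ, n 0 ^ 2 + n 1 ^ 2 + n 2 ^ 2 = 1 ∧ L n = 0 := by
  obtain ⟨x, hx, hx0⟩ := Submodule.exists_mem_ne_zero_of_ne_bot
    (LinearMap.ker_ne_bot_of_finrank_lt (f := L) (by simp))
  have hpos : 0 < x 0 ^ 2 + x 1 ^ 2 + x 2 ^ 2 := by
    by_contra h
    refine hx0 (funext fun i => ?_)
    have h0 := sq_nonneg (x 0)
    have h1 := sq_nonneg (x 1)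
    have h2 := sq_nonneg (x 2)
    fin_cases i <;> refine pow_eq_zero_iff two_ne_zero |>.1 ?_ <;> dsimp <;> linarith
  have h2 := Real.sq_sqrt hpos.le
  have h2' := (Real.sqrt_pos.2 hpos).ne'
  refine ⟨(√(x 0 ^ 2 + x 1 ^ 2 + x 2 ^ 2))⁻¹ • x, ?_, by simp [LinearMap.mem_ker.1 hx]⟩
  simp only [Pi.smul_apply, smul_eq_mul]
  generalize √(x 0 ^ 2 + x 1 ^ 2 + x 2 ^ 2) = t at h2 h2'
  field_simp
  exact h2.symm

namespace HermitianStructure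

variable {S : HermitianStructure 𝔤} {a b c : 𝔤}

/-- The linear parametrization of the three-dimensional space orthogonal to `a` and to the
centre. -/
def frameVec (S : HermitianStructure 𝔤) (a b : 𝔤) : (Fin 3 → ℝ) →ₗ[ℝ] 𝔤 :=
  Fintype.linearCombination ℝ ![S.J a, b, S.J b]

theorem frameVec_apply (n : Fin 3 → ℝ) :
    S.frameVec a b n = n 0 • S.J a + n 1 • b + n 2 • S.J b := by
  simp [frameVec, Fintype.linearCombination_apply, Fin.sum_univ_three]

namespace IsAdaptedTriple

/-- This is the vanishing trace of the bracket in the unitary frame `a, J a, b, J b`, where `F` is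
nonzero only on the pairs `a, J a` and `b, J b`. -/
theorem lie_b_Jb (h : S.IsAdaptedTriple a b c) (hF : S.IsBalanced) :
    ⁅b, S.J b⁆ = -⁅a, S.J a⁆ := by
  have key := h.sum_lie_eq_zero hF (f := ![a, S.J a, b, S.J b])
    (fun i => by fin_cases i <;> simp [h.ca, h.cb, h.g_J_eq])
    (fun i => by fin_cases i <;> simp [h.Jca, h.Jcb, h.ca, h.cb, S.g_J])
  simp [F_apply, S.J_sq, h.aa, h.bb, h.ab, h.g_J_eq, S.g_J, h.Jab] at key
  rw [← lie_skew b, ← lie_skew a, neg_neg, neg_eq_iff_add_eq_zero, add_comm]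
  exact key

/-- An anti-self-dual form on `ℝ ⊕ ℝ³` is determined by its contraction with the unit vector of `ℝ`,
the rest being given by the cross product. Here this is read off from the three relations that
Abelian and balanced impose on the frame. -/
theorem lie_frameVec_frameVec (h : S.IsAdaptedTriple a b c) (hab : S.IsAbelian)
    (hF : S.IsBalanced) (n m : Fin 3 → ℝ) :
    ⁅S.frameVec a b n, S.frameVec a b m⁆ = -⁅a, S.frameVec a b (crossProduct n m)⁆ := by
  have h1 : ⁅S.J a, S.J b⁆ = ⁅a, b⁆ := hab a b
  have h2 : ⁅S.J a, b⁆ = -⁅a, S.J b⁆ := hab.lie_J_left a b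
  have h3 : ⁅S.J b, S.J a⁆ = -⁅a, b⁆ := by rw [← lie_skew, h1]
  have h4 : ⁅b, S.J a⁆ = ⁅a, S.J b⁆ := by rw [← lie_skew, h2, neg_neg]
  have h5 : ⁅S.J b, b⁆ = ⁅a, S.J a⁆ := by rw [← lie_skew, h.lie_b_Jb hF, neg_neg]
  simp only [frameVec_apply, lie_add, lie_smul, add_lie, smul_lie, lie_self, h1, h2, h3, h4,
    h5, h.lie_b_Jb hF, cross_apply, Matrix.cons_val]
  module

/-- Central vectors are orthogonal to `a, J a, b, J b`, so pairing a linear relation with these four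
isolates its noncentral part. -/
theorem linearIndependent_frame (h : S.IsAdaptedTriple a b c) {n m k : Fin 3 → ℝ} {u w : 𝔤}
    (hnmk : LinearIndependent ℝ ![n, m, k]) (huw : LinearIndependent ℝ ![u, w])
    (hu : ∀ y : 𝔤, ⁅u, y⁆ = 0) (hw : ∀ y : 𝔤, ⁅w, y⁆ = 0) : LinearIndependent ℝ
      ![a, S.frameVec a b n, S.frameVec a b m, S.frameVec a b k, u, w] := by
  have hcen : ∀ {x : 𝔤}, (∀ y : 𝔤, ⁅x, y⁆ = 0) → S.g a x = 0 ∧ S.g (S.J a) x = 0 ∧ S.g b x = 0 ∧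
      S.g (S.J b) x = 0 := by
    intro x hx
    rw [h.eq_of_central x hx]
    refine ⟨?_, ?_, ?_, ?_⟩ <;> rw [S.g_symm] <;>
      simp [S.g_J, h.ca, h.cb, h.Jca, h.Jcb, h.g_J_eq]
  obtain ⟨u1, u2, u3, u4⟩ := hcen hu
  obtain ⟨w1, w2, w3, w4⟩ := hcen hw
  rw [Fintype.linearIndependent_iff] at hnmk huw ⊢
  intro x hx
  simp only [Fin.sum_univ_six, Matrix.cons_val, frameVec_apply] at hx
  have e0 := congrArg (S.g a) hx
  have e1 := congrArg (S.g (S.J a)) hx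
  have e2 := congrArg (S.g b) hx
  have e3 := congrArg (S.g (S.J b)) hx
  have f3 := h.ab
  have f6 := h.Jab
  rw [S.g_symm] at f3 f6
  have f7 : S.g (S.J b) a = 0 := by rw [S.g_symm, h.g_J_eq.2.2]
  have f8 : ∀ x, S.g (S.J x) x = 0 := fun x => by rw [S.g_symm, S.g_self_J]
  simp [h.aa, h.bb, S.g_J, u1, u2, u3, u4, w1, w2, w3, w4, h.ab, h.Jab, f3, f6, f7, S.g_self_J,
    h.g_J_eq, f8] at e0 e1 e2 e3
  have hnmk' := hnmk ![x 1, x 2, x 3] (by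
    funext i
    simp only [Fin.sum_univ_three, Matrix.cons_val]
    fin_cases i <;> simp <;> linarith)
  have x1 : x 1 = 0 := hnmk' 0
  have x2 : x 2 = 0 := hnmk' 1
  have x3 : x 3 = 0 := hnmk' 2
  have huw' := huw ![x 4, x 5] (by
    simp [e0, x1, x2, x3] at hx
    simpa using hx)
  have x4 : x 4 = 0 := huw' 0
  have x5 : x 5 = 0 := huw' 1
  intro i
  fin_cases i <;> assumption

open Matrix in
theorem exists_lie_frameVec_ne_zero [IsTwoStepNilpotent 𝔤] (h : S.IsAdaptedTriple a b c)
    (hdim : Module.finrank ℝ 𝔤 = 6) (hab : S.IsAbelian) (hF : S.IsBalanced) :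
    ∃ x, ⁅a, S.frameVec a b x⁆ ≠ 0 := by
  by_contra! hall
  obtain ⟨x₀, y₀, h₀⟩ := IsTwoStepNilpotent.exists_lie_ne_zero (𝔤 := 𝔤)
  have hexp : ∀ x, ∃ (s t r : ℝ) (n : Fin 3 → ℝ),
      x = s • a + S.frameVec a b n + t • c + r • S.J c := fun x => by
    refine ⟨S.g a x, S.g c x, S.g (S.J c) x, ![S.g (S.J a) x, S.g b x, S.g (S.J b) x], ?_⟩
    conv_lhs => rw [h.eq_sum hdim x]
    simp only [frameVec_apply, Matrix.cons_val]
    abel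
  have hall' : ∀ x, ⁅S.frameVec a b x, a⁆ = 0 := fun x => by rw [← lie_skew, hall, neg_zero]
  obtain ⟨s, t, r, n, hx⟩ := hexp x₀
  obtain ⟨s', t', r', n', hy⟩ := hexp y₀
  refine h₀ ?_
  rw [hx, hy]
  simp [h.lie_c, h.lie_Jc, h.lie_right, h.lie_J_right, hall, hall',
    h.lie_frameVec_frameVec hab hF]

end IsAdaptedTriple

/-! ### Cross products in three-space -/

open Matrix

theorem linearIndependent_of_orthogonal_triple {n m k : Fin 3 → ℝ} (hn : n ⬝ᵥ n ≠ 0)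
    (hm : m ⬝ᵥ m ≠ 0) (hk : k ⬝ᵥ k ≠ 0) (hnm : n ⬝ᵥ m = 0) (hnk : n ⬝ᵥ k = 0)
    (hmk : m ⬝ᵥ k = 0) : LinearIndependent ℝ ![n, m, k] := by
  rw [Fintype.linearIndependent_iff]
  intro x hx
  simp only [Fin.sum_univ_three, Matrix.cons_val] at hx
  have e0 := congrArg (fun v => n ⬝ᵥ v) hx
  have e1 := congrArg (fun v => m ⬝ᵥ v) hx
  have e2 := congrArg (fun v => k ⬝ᵥ v) hx
  simp [hnm, hnk, hmk, dotProduct_comm m n, dotProduct_comm k n, dotProduct_comm k m, hn, hm, hk]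
    at e0 e1 e2
  intro i
  fin_cases i <;> assumption

theorem cross_cross_self (n m : Fin 3 → ℝ) :
    crossProduct n (crossProduct n m) = (n ⬝ᵥ m) • n - (n ⬝ᵥ n) • m := by
  funext i
  fin_cases i <;> simp [cross_apply, dotProduct, Fin.sum_univ_three] <;> ring

theorem cross_cross_self' (n m : Fin 3 → ℝ) :
    crossProduct m (crossProduct n m) = (m ⬝ᵥ m) • n - (n ⬝ᵥ m) • m := by
  funext i
  fin_cases i <;> simp [cross_apply, dotProduct, Fin.sum_univ_three] <;> ring

theorem eq_sum_cross {n m : Fin 3 → ℝ} (hn : n ⬝ᵥ n = 1) (hm : m ⬝ᵥ m = 1) (hnm : n ⬝ᵥ m = 0)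
    (x : Fin 3 → ℝ) :
    x = (x ⬝ᵥ n) • n + (x ⬝ᵥ m) • m + (x ⬝ᵥ crossProduct n m) • crossProduct n m := by
  simp only [dotProduct, Fin.sum_univ_three] at hn hm hnm
  funext i
  fin_cases i <;> simp [cross_apply, dotProduct, Fin.sum_univ_three] <;> grind

theorem exists_unit_orthogonal_fin_three (m : Fin 3 → ℝ) : ∃ n : Fin 3 → ℝ,
    n ⬝ᵥ n = 1 ∧ n ⬝ᵥ m = 0 := by
  obtain ⟨n, hn, hn0⟩ := exists_unit_mem_ker
    (LinearMap.pi fun _ => Fintype.linearCombination ℝ m)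
  refine ⟨n, ?_, ?_⟩
  · simp only [dotProduct, Fin.sum_univ_three, ← hn]
    ring
  · simpa [dotProduct, Fintype.linearCombination_apply] using congrFun hn0 0

/-! ### Normal forms according to the rank of `x ↦ [a, x]` -/

namespace IsAdaptedTriple

theorem nonempty_lieEquiv_H3 (h : S.IsAdaptedTriple a b c) (hdim : Module.finrank ℝ 𝔤 = 6)
    (hab : S.IsAbelian) (hF : S.IsBalanced) {w : 𝔤} {m : Fin 3 → ℝ} (hm : m ≠ 0) (hw : w ≠ 0)
    (hlie : ∀ x, ⁅a, S.frameVec a b x⁆ = (x ⬝ᵥ m) • w) : Nonempty (𝔤 ≃ₗ⁅ℝ⁆ H3) := by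
  obtain ⟨n, hn, hnm⟩ := exists_unit_orthogonal_fin_three m
  have hmm : m ⬝ᵥ m ≠ 0 := fun h => hm (dotProduct_self_eq_zero.1 h)
  obtain ⟨q, hq⟩ : ∃ q, q = ⁅a, S.frameVec a b m⁆ := ⟨_, rfl⟩
  have hqw : q = (m ⬝ᵥ m) • w := by rw [hq, hlie]
  have hq0 : q ≠ 0 := by rw [hqw]; exact smul_ne_zero hmm hw
  have hqc : ∀ y : 𝔤, ⁅q, y⁆ = 0 := fun y => by rw [hq, h.lie_lie]
  have hJqc := hab.lie_J_eq_zero hqc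
  have hkk : crossProduct n m ⬝ᵥ crossProduct n m ≠ 0 := by
    rw [cross_dot_cross, hn, hnm]
    simpa using hmm
  have hnk : n ⬝ᵥ crossProduct n m = 0 := dot_self_cross n m
  have hmk : m ⬝ᵥ crossProduct n m = 0 := dot_cross_self n m
  have hnq : ⁅a, S.frameVec a b n⁆ = 0 := by rw [hlie, hnm, zero_smul]
  have hkq : ⁅a, S.frameVec a b (crossProduct n m)⁆ = 0 := by
    rw [hlie, dotProduct_comm, hmk, zero_smul]
  have hqJq : LinearIndependent ℝ ![S.J q, -q] := by
    rw [LinearIndependent.pair_iff]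
    intro s t hst
    have e0 := congrArg (S.g q) hst
    have e1 := congrArg (S.g (S.J q)) hst
    have hpos := (S.g_pos q hq0).ne'
    simp [S.g_self_J, S.g_J, hpos, S.g_symm (S.J q) q] at e0 e1
    exact ⟨e1, e0⟩
  -- The `H3` basis is `a, m, n, n × m, J q, -q`. Since `n` is a unit vector orthogonal to `m`, `n ×
  -- (n × m) = -m`, so `⁅a, m⁆` and `⁅n, n × m⁆` are both `q`; `J q` only fills up the centre.
  have hLI := h.linearIndependent_frame (linearIndependent_of_orthogonal_triple hmm
    (by rw [hn]; exact one_ne_zero) hkk (by rw [dotProduct_comm, hnm]) hmk hnk) hqJq hJqc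
    (fun y => by rw [neg_lie, hqc, neg_zero])
  refine Nilmanifold.nonempty_lieEquiv_H3 hdim hLI hJqc
    (fun y => by simp only [Matrix.cons_val, neg_lie, hqc, neg_zero]) ?_ ?_ ?_ ?_ ?_ ?_ <;>
    simp only [Matrix.cons_val, neg_neg, h.lie_frameVec_frameVec hab hF, hnq, hkq,
      cross_cross_self, cross_cross_self', map_sub, map_smul, lie_sub, lie_smul, hn, hnm, ← hq]
  · simp
  · rw [← cross_anticomm, map_neg, lie_neg, hkq, neg_zero, neg_zero]
  · simp

/-- The map `x ↦ [a, x]` goes from a three-space to the two-dimensional centre, so it kills a unit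
vector `n`. Completing `n` to an orthonormal frame `n, m, k` with `k = n × m`, everything depends on
whether the images `q, r` of `m, k` are independent. -/
theorem nonempty_lieEquiv [IsTwoStepNilpotent 𝔤] (h : S.IsAdaptedTriple a b c)
    (hdim : Module.finrank ℝ 𝔤 = 6) (hab : S.IsAbelian) (hF : S.IsBalanced) :
    Nonempty (𝔤 ≃ₗ⁅ℝ⁆ H3) ∨ Nonempty (𝔤 ≃ₗ⁅ℝ⁆ H5) := by
  obtain ⟨n, hn, hn0⟩ := exists_unit_mem_ker
    (LinearMap.pi ![S.g c ∘ₗ (LieAlgebra.ad ℝ 𝔤 a) ∘ₗ S.frameVec a b,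
      S.g (S.J c) ∘ₗ (LieAlgebra.ad ℝ 𝔤 a) ∘ₗ S.frameVec a b])
  have hn1 : n ⬝ᵥ n = 1 := by
    simp only [dotProduct, Fin.sum_univ_three, ← hn]
    ring
  have hnq : ⁅a, S.frameVec a b n⁆ = 0 := by
    have h0 := congrFun hn0 0
    have h1 := congrFun hn0 1
    simp only [LinearMap.pi_apply, Matrix.cons_val, LinearMap.comp_apply, LieAlgebra.ad_apply,
      Pi.zero_apply] at h0 h1
    rw [h.lie_eq, h0, h1, zero_smul, zero_smul, add_zero]
  obtain ⟨m, hm, hmn⟩ := exists_unit_orthogonal_fin_three n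
  have hnm : n ⬝ᵥ m = 0 := by rw [dotProduct_comm, hmn]
  obtain ⟨k, hk⟩ : ∃ k, k = crossProduct n m := ⟨_, rfl⟩
  obtain ⟨q, hq⟩ : ∃ q, q = ⁅a, S.frameVec a b m⁆ := ⟨_, rfl⟩
  obtain ⟨r, hr⟩ : ∃ r, r = ⁅a, S.frameVec a b k⁆ := ⟨_, rfl⟩
  have hexp : ∀ x, ⁅a, S.frameVec a b x⁆ = (x ⬝ᵥ m) • q + (x ⬝ᵥ k) • r := fun x => by
    conv_lhs => rw [eq_sum_cross hn1 hm hnm x]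
    rw [map_add, map_add, map_smul, map_smul, map_smul, lie_add, lie_add, lie_smul, lie_smul,
      lie_smul, hnq, ← hk, ← hq, ← hr, smul_zero, zero_add]
  obtain ⟨x, hx⟩ := h.exists_lie_frameVec_ne_zero hdim hab hF
  have hH3 : ∀ (w : 𝔤) (m : Fin 3 → ℝ), (∀ x, ⁅a, S.frameVec a b x⁆ = (x ⬝ᵥ m) • w) →
      Nonempty (𝔤 ≃ₗ⁅ℝ⁆ H3) := fun w m hwm =>
    h.nonempty_lieEquiv_H3 hdim hab hF
      (fun hm0 => hx (by rw [hwm, hm0, dotProduct_zero, zero_smul]))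
      (fun hw0 => hx (by rw [hwm, hw0, smul_zero])) hwm
  by_cases hLI : LinearIndependent ℝ ![q, r]
  · right
    have hkk : k ⬝ᵥ k = 1 := by
      rw [hk, cross_dot_cross, hn1, hm, hnm, hmn]
      norm_num
    have hLI' : LinearIndependent ℝ ![-q, -r] := by
      rw [LinearIndependent.pair_iff] at hLI ⊢
      intro s t hst
      exact hLI s t (by rw [← neg_eq_zero, ← hst]; module)
    have hqc : ∀ y : 𝔤, ⁅-q, y⁆ = 0 := fun y => by rw [hq, neg_lie, h.lie_lie, neg_zero]
    have hrc : ∀ y : 𝔤, ⁅-r, y⁆ = 0 := fun y => by rw [hr, neg_lie, h.lie_lie, neg_zero]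
    -- The signs of `-n`, `-q`, `-r` match the structure equations of `H5` under the convention
    -- `de(x, y) = -e([x, y])`.
    have hLI6 := h.linearIndependent_frame (linearIndependent_of_orthogonal_triple (n := -n)
      (m := m) (k := k) (by simp [hn1]) (by simp [hm]) (by simp [hkk]) (by simp [hnm])
      (by simp [hk]) (by simp [hk])) hLI' hqc hrc
    refine nonempty_lieEquiv_H5 hdim hLI6 hqc hrc ?_ ?_ ?_ ?_ ?_ ?_ <;>
      simp only [Matrix.cons_val, map_neg, lie_neg, neg_lie, neg_neg,
        h.lie_frameVec_frameVec hab hF, ← hq, ← hr, hnq, neg_zero]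
    · simp [hk, cross_cross_self', hnm, hm, hnq]
    · simp [hk, cross_cross_self, hnm, hn1, hq]
    · rw [hr, hk]
  · left
    rw [LinearIndependent.pair_iff] at hLI
    push Not at hLI
    obtain ⟨s, t, hst, hne⟩ := hLI
    by_cases hs : s = 0
    · have ht := hne hs
      have hr0 : r = 0 := by simpa [hs, ht] using hst
      exact hH3 q m fun x => by rw [hexp, hr0, smul_zero, add_zero]
    · have hqr : q = (-(s⁻¹ * t)) • r := by
        rw [eq_comm, ← sub_eq_zero]
        rw [← smul_eq_zero_iff_right hs, ← neg_eq_zero, ← hst, smul_sub, smul_smul]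
        field_simp
        module
      -- Substituting `q = -(s⁻¹ t) r` in `hexp` collects the bracket into a single multiple of `r`.
      exact hH3 r (k - (s⁻¹ * t) • m) fun x => by
        rw [hexp, hqr]
        simp only [dotProduct_sub, dotProduct_smul, smul_eq_mul]
        module

end IsAdaptedTriple
end HermitianStructure
end Classification

/-! ### Bundles with anti-self-dual curvature have Abelian complex structure -/

theorem AntiSelfDualTorusBundle.isAbelian {𝔤 : Type*} [LieRing 𝔤] [LieAlgebra ℝ 𝔤]
    [IsTwoStepNilpotent 𝔤] (hdim : Module.finrank ℝ 𝔤 = 6)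
    {Γ : Subgroup (SimplyConnectedGroup 𝔤)} {S : HermitianStructure 𝔤}
    (T : AntiSelfDualTorusBundle Γ S) : S.IsAbelian := by
  have : Module.Finite ℝ 𝔤 := Module.finite_of_finrank_pos (by omega)
  obtain ⟨L, hL⟩ : ∃ L : 𝔤 →ₗ[ℝ] (Fin 4 → ℝ) × (Fin 2 → ℝ),
      L = T.P.prod (LinearMap.pi T.η) := ⟨_, rfl⟩
  have hLx : ∀ x, L x = (T.P x, fun i => T.η i x) := fun x => by rw [hL]; rfl
  have hinj : Function.Injective L := by
    refine (injective_iff_map_eq_zero L).2 fun x hx => ?_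
    rw [hLx, Prod.mk_eq_zero] at hx
    by_contra hne
    have h0 : T.η 0 x = 0 := congrFun hx.2 0
    have h1 : T.η 1 x = 0 := congrFun hx.2 1
    have := S.g_pos x hne
    rw [T.g_eq, hx.1, h0, h1] at this
    simp at this
  have hsurj := (LinearMap.injective_iff_surjective_of_finrank_eq_finrank (by simp [hdim])).1 hinj
  have hPJ : ∀ y, T.P (S.J y) = T.base.J (T.P y) := by
    intro y
    rw [← sub_eq_zero]
    by_contra hne
    -- Testing the formula for `F` against the horizontal lift `x` of the defect shows that the
    -- defect has norm zero.
    obtain ⟨x, hx⟩ := hsurj (T.P (S.J y) - T.base.J (T.P y), 0)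
    rw [hLx, Prod.mk.injEq] at hx
    have h0 : T.η 0 x = 0 := congrFun hx.2 0
    have h1 : T.η 1 x = 0 := congrFun hx.2 1
    have hpos := T.base.g_pos _ hne
    have hF := T.F_eq x y
    rw [HermitianStructure.F_apply, HermitianStructure.F_apply, T.g_eq, h0, h1, hx.1] at hF
    rw [map_sub (T.base.g _)] at hpos
    linarith
  intro x y
  refine hinj ?_
  rw [hLx, hLx, T.P_lie, T.P_lie, Prod.mk.injEq]
  refine ⟨rfl, funext fun i => ?_⟩
  have h1 := T.dη_eq i (S.J x) (S.J y)
  rw [hPJ, hPJ, (T.antiSelfDual i).map_J, ← T.dη_eq i x y, dOne, dOne] at h1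
  linarith

/-! ### Tori and the topology of nilmanifolds -/

section Torus

variable {n : ℕ}

theorem toTorus_add (u v : Fin n → ℝ) : toTorus (u + v) = toTorus u + toTorus v := rfl

theorem toTorus_zero : toTorus (0 : Fin n → ℝ) = 0 := rfl

theorem toTorus_eq_iff {u v : Fin n → ℝ} :
    toTorus u = toTorus v ↔ ∃ z : Fin n → ℤ, v = u + fun i => (z i : ℝ) := by
  have key : ∀ i, (u i : UnitAddCircle) = (v i : UnitAddCircle) ↔ ∃ z : ℤ, v i = u i + z := by
    intro i
    rw [eq_comm, ← sub_eq_zero, ← AddCircle.coe_sub, AddCircle.coe_eq_zero_iff]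
    refine exists_congr fun z => ?_
    rw [zsmul_one, eq_sub_iff_add_eq, eq_comm, add_comm]
  constructor
  · intro h
    choose z hz using fun i => (key i).1 (congrFun h i)
    exact ⟨z, funext hz⟩
  · rintro ⟨z, hz⟩
    exact funext fun i => (key i).2 ⟨z i, congrFun hz i⟩

theorem toTorus_surjective : Function.Surjective (toTorus (n := n)) := fun t => by
  choose u hu using fun i => QuotientAddGroup.mk_surjective (t i)
  exact ⟨u, funext hu⟩

theorem continuous_toTorus : Continuous (toTorus (n := n)) :=
  continuous_pi fun i => (AddCircle.continuous_mk' 1).comp (continuous_apply i)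

theorem isOpenMap_toTorus : IsOpenMap (toTorus (n := n)) :=
  IsOpenMap.piMap (fun _ => QuotientAddGroup.isOpenMap_coe)
    (Filter.Eventually.of_forall fun _ => QuotientAddGroup.mk_surjective)

/-- In the sup metric, two points of a ball of radius 1/2 differ by less than 1 in each coordinate.
-/
theorem int_eq_zero_of_mem_ball {u₀ u : Fin n → ℝ} {z : Fin n → ℤ}
    (hu : u ∈ Metric.ball u₀ (1 / 2)) (hz : (u + fun i => (z i : ℝ)) ∈ Metric.ball u₀ (1 / 2)) :
    z = 0 := by
  funext i
  rw [Metric.mem_ball] at hu hz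
  have h1 := (dist_le_pi_dist _ _ i).trans_lt hu
  have h2 := (dist_le_pi_dist _ _ i).trans_lt hz
  rw [Real.dist_eq, abs_lt] at h1 h2
  simp only [Pi.add_apply] at h2
  have h3 : ((z i : ℤ) : ℝ) < 1 := by linarith
  have h4 : (-1 : ℝ) < ((z i : ℤ) : ℝ) := by linarith
  have h5 : z i < 1 := by exact_mod_cast h3
  have h6 : -1 < z i := by exact_mod_cast h4
  simp only [Pi.zero_apply]
  omega

end Torus

/-! ### Maps induced on quotients by open maps -/

theorem continuousOn_image_of_isOpenMap {X Y Z : Type*} [TopologicalSpace X]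
    [TopologicalSpace Y] [TopologicalSpace Z] {p : X → Y} {q : X → Z} (hp : Continuous p)
    (hpo : IsOpenMap p) (hq : Continuous q) {W : Set X} (hW : IsOpen W) {f : Y → Z}
    (hf : ∀ a ∈ W, f (p a) = q a) : ContinuousOn f (p '' W) := by
  rintro _ ⟨a, ha, rfl⟩
  refine ContinuousAt.continuousWithinAt ?_
  rw [ContinuousAt, ← hpo.map_nhds_eq hp.continuousAt, Filter.tendsto_map'_iff, hf a ha]
  exact hq.continuousAt.congr' (Filter.mem_of_superset (hW.mem_nhds ha) fun b hb => (hf b hb).symm)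

/-- Two open continuous maps that identify the same points of an open set induce a homeomorphism
between the images of that set. -/
theorem exists_openPartialHomeomorph_of_isOpenMap {X Y Z : Type*} [TopologicalSpace X]
    [TopologicalSpace Y] [TopologicalSpace Z] {p : X → Y} {q : X → Z} (hp : Continuous p)
    (hpo : IsOpenMap p) (hq : Continuous q) (hqo : IsOpenMap q) {W : Set X} (hW : IsOpen W)
    (hne : W.Nonempty) (hpq : ∀ a ∈ W, ∀ b ∈ W, p a = p b ↔ q a = q b) :
    ∃ e : OpenPartialHomeomorph Y Z,
      e.source = p '' W ∧ e.target = q '' W ∧ ∀ a ∈ W, e (p a) = q a := by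
  have : Nonempty X := hne.to_type
  -- The chosen preimages need not vary continuously; by `hpq` the induced map does not depend on
  -- them, and its continuity comes from the openness of `p`.
  have hf : ∀ a ∈ W, q (Function.invFunOn p W (p a)) = q a := fun a ha =>
    (hpq _ (Function.invFunOn_mem ⟨a, ha, rfl⟩) _ ha).1 (Function.invFunOn_eq ⟨a, ha, rfl⟩)
  have hg : ∀ a ∈ W, p (Function.invFunOn q W (q a)) = p a := fun a ha =>
    (hpq _ (Function.invFunOn_mem ⟨a, ha, rfl⟩) _ ha).2 (Function.invFunOn_eq ⟨a, ha, rfl⟩)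
  refine ⟨{ toFun := fun y => q (Function.invFunOn p W y)
            invFun := fun z => p (Function.invFunOn q W z)
            source := p '' W
            target := q '' W
            map_source' := ?_
            map_target' := ?_
            left_inv' := ?_
            right_inv' := ?_
            open_source := hpo W hW
            open_target := hqo W hW
            continuousOn_toFun := continuousOn_image_of_isOpenMap hp hpo hq hW hf
            continuousOn_invFun := continuousOn_image_of_isOpenMap hq hqo hp hW hg }, rfl, rfl, hf⟩
  · rintro _ ⟨a, ha, rfl⟩
    exact ⟨a, ha, (hf a ha).symm⟩
  · rintro _ ⟨a, ha, rfl⟩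
    exact ⟨a, ha, (hg a ha).symm⟩
  · rintro _ ⟨a, ha, rfl⟩
    simp only [hf a ha, hg a ha]
  · rintro _ ⟨a, ha, rfl⟩
    simp only [hf a ha, hg a ha]

section Topology

variable {𝔤 : Type*} [LieRing 𝔤] [LieAlgebra ℝ 𝔤]

theorem continuous_linearMap_log {E : Type*} [AddCommGroup E] [Module ℝ E] [TopologicalSpace E]
    [ContinuousAdd E] [ContinuousSMul ℝ E] (f : 𝔤 →ₗ[ℝ] E) :
    Continuous fun a : SimplyConnectedGroup 𝔤 => f a.log := by
  let _ : TopologicalSpace 𝔤 := moduleTopology ℝ 𝔤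
  have : IsModuleTopology ℝ 𝔤 := ⟨rfl⟩
  exact (IsModuleTopology.continuous_of_linearMap f).comp continuous_induced_dom

theorem continuous_exp_linearMap {E : Type*} [AddCommGroup E] [Module ℝ E] [TopologicalSpace E]
    [IsModuleTopology ℝ E] (f : E →ₗ[ℝ] 𝔤) :
    Continuous fun u : E => (exp (f u) : SimplyConnectedGroup 𝔤) := by
  let _ : TopologicalSpace 𝔤 := moduleTopology ℝ 𝔤
  have : IsModuleTopology ℝ 𝔤 := ⟨rfl⟩
  have : ContinuousAdd 𝔤 := IsModuleTopology.toContinuousAdd ℝ 𝔤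
  exact continuous_induced_rng.2 (IsModuleTopology.continuous_of_linearMap f)

theorem continuous_const_mul_group (a : SimplyConnectedGroup 𝔤) :
    Continuous fun b : SimplyConnectedGroup 𝔤 => a * b := by
  let _ : TopologicalSpace 𝔤 := moduleTopology ℝ 𝔤
  have : IsModuleTopology ℝ 𝔤 := ⟨rfl⟩
  have : ContinuousAdd 𝔤 := IsModuleTopology.toContinuousAdd ℝ 𝔤
  refine continuous_induced_rng.2 ?_
  have h : (log ∘ fun b : SimplyConnectedGroup 𝔤 => a * b) = fun b => a.log +
      (LinearMap.id + (2⁻¹ : ℝ) • LieAlgebra.ad ℝ 𝔤 a.log : 𝔤 →ₗ[ℝ] 𝔤) b.log := by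
    funext b
    simp [add_assoc]
  rw [h]
  exact continuous_const.add (continuous_linearMap_log _)

variable [IsTwoStepNilpotent 𝔤]

theorem mk_eq_mk_iff {Γ : Subgroup (SimplyConnectedGroup 𝔤)} {a b : SimplyConnectedGroup 𝔤} :
    (Quotient.mk _ a : Space Γ) = Quotient.mk _ b ↔ ∃ γ ∈ Γ, b = γ * a := by
  rw [Quotient.eq, QuotientGroup.rightRel_apply]
  exact ⟨fun h => ⟨_, h, by simp⟩, by rintro ⟨γ, hγ, rfl⟩; simpa using hγ⟩

theorem continuous_space_mk (Γ : Subgroup (SimplyConnectedGroup 𝔤)) :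
    Continuous (Quotient.mk _ : SimplyConnectedGroup 𝔤 → Space Γ) :=
  continuous_quot_mk

theorem isOpenMap_space_mk (Γ : Subgroup (SimplyConnectedGroup 𝔤)) :
    IsOpenMap (Quotient.mk _ : SimplyConnectedGroup 𝔤 → Space Γ) := by
  have : ContinuousConstSMul Γ (SimplyConnectedGroup 𝔤) :=
    ⟨fun γ => continuous_const_mul_group (γ : SimplyConnectedGroup 𝔤)⟩
  exact isOpenMap_quotient_mk'_mul (Γ := Γ) (T := SimplyConnectedGroup 𝔤)

end Topology

/-! ### Torus bundles from integral splittings -/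

/-- A linear splitting `𝔤 = ℝᵏ ⊕ ℝᵐ`, where `ℝᵐ` is the centre and contains the brackets. -/
structure CentralSplitting (𝔤 : Type*) [LieRing 𝔤] [LieAlgebra ℝ 𝔤] (k m : ℕ) where
  P : 𝔤 →ₗ[ℝ] (Fin k → ℝ)
  σ : (Fin k → ℝ) →ₗ[ℝ] 𝔤
  ξ : (Fin m → ℝ) →ₗ[ℝ] 𝔤
  ζ : 𝔤 →ₗ[ℝ] (Fin m → ℝ)
  P_σ : ∀ u, P (σ u) = u
  P_ξ : ∀ s, P (ξ s) = 0
  ζ_σ : ∀ u, ζ (σ u) = 0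
  ζ_ξ : ∀ s, ζ (ξ s) = s
  σ_P_add_ξ_ζ : ∀ x, σ (P x) + ξ (ζ x) = x
  ξ_lie : ∀ s (y : 𝔤), ⁅ξ s, y⁆ = 0
  P_lie : ∀ x y : 𝔤, P ⁅x, y⁆ = 0
  P_eq_zero : ∀ x : 𝔤, (∀ y : 𝔤, ⁅x, y⁆ = 0) → P x = 0

namespace CentralSplitting

variable {𝔤 : Type*} [LieRing 𝔤] [LieAlgebra ℝ 𝔤] {k m : ℕ} (D : CentralSplitting 𝔤 k m)

theorem lie_ξ (x : 𝔤) (s : Fin m → ℝ) : ⁅x, D.ξ s⁆ = 0 := by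
  rw [← lie_skew, D.ξ_lie, neg_zero]

theorem eq_ξ_of_P_eq_zero {x : 𝔤} (hx : D.P x = 0) : x = D.ξ (D.ζ x) := by
  have := D.σ_P_add_ξ_ζ x
  rw [hx, map_zero, zero_add] at this
  exact this.symm

theorem lie_eq_lie_σ_left (x y : 𝔤) : ⁅D.σ (D.P x), y⁆ = ⁅x, y⁆ := by
  conv_rhs => rw [← D.σ_P_add_ξ_ζ x]
  rw [add_lie, D.ξ_lie, add_zero]

theorem lie_eq_lie_σ_right (x y : 𝔤) : ⁅x, D.σ (D.P y)⁆ = ⁅x, y⁆ := by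
  rw [← lie_skew, D.lie_eq_lie_σ_left, lie_skew]

theorem P_log_mul (a b : SimplyConnectedGroup 𝔤) :
    D.P (a * b).log = D.P a.log + D.P b.log := by
  simp [D.P_lie]

theorem exp_ξ_mul (s : Fin m → ℝ) (a : SimplyConnectedGroup 𝔤) :
    (exp (D.ξ s) * a : SimplyConnectedGroup 𝔤) = exp (a.log + D.ξ s) := by
  ext
  simp [D.ξ_lie, add_comm]

theorem mul_exp_ξ (s : Fin m → ℝ) (a : SimplyConnectedGroup 𝔤) :
    (a * exp (D.ξ s) : SimplyConnectedGroup 𝔤) = exp (a.log + D.ξ s) := by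
  ext
  simp [D.lie_ξ]

/-- Changes of bases of the two summands. -/
def change (A : (Fin k → ℝ) ≃ₗ[ℝ] (Fin k → ℝ)) (C : (Fin m → ℝ) ≃ₗ[ℝ] (Fin m → ℝ)) :
    CentralSplitting 𝔤 k m where
  P := A.toLinearMap ∘ₗ D.P
  σ := D.σ ∘ₗ A.symm.toLinearMap
  ξ := D.ξ ∘ₗ C.symm.toLinearMap
  ζ := C.toLinearMap ∘ₗ D.ζ
  P_σ u := by simp [D.P_σ]
  P_ξ s := by simp [D.P_ξ]
  ζ_σ u := by simp [D.ζ_σ]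
  ζ_ξ s := by simp [D.ζ_ξ]
  σ_P_add_ξ_ζ x := by simp [D.σ_P_add_ξ_ζ]
  ξ_lie s y := by simp [D.ξ_lie]
  P_lie x y := by simp [D.P_lie]
  P_eq_zero x hx := by simp [D.P_eq_zero x hx]

/-- The homeomorphism of the group with `ℝᵏ × ℝᵐ`. -/
def homeomorph : SimplyConnectedGroup 𝔤 ≃ₜ (Fin k → ℝ) × (Fin m → ℝ) where
  toFun a := (D.P a.log, D.ζ a.log)
  invFun x := exp ((D.σ.coprod D.ξ) x)
  left_inv a := by
    ext
    simp [D.σ_P_add_ξ_ζ]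
  right_inv x := by
    ext <;> simp [D.P_σ, D.P_ξ, D.ζ_σ, D.ζ_ξ]
  continuous_toFun := (continuous_linearMap_log D.P).prodMk (continuous_linearMap_log D.ζ)
  continuous_invFun := continuous_exp_linearMap _

variable [IsTwoStepNilpotent 𝔤]

/-- The splitting is compatible with the subgroup `Γ`: the image of `Γ` in `ℝᵏ` is `ℤᵏ`, and its
intersection with the centre is `ℤᵐ`. -/
structure IsIntegral (Γ : Subgroup (SimplyConnectedGroup 𝔤)) : Prop where
  P_mem : ∀ γ ∈ Γ, ∃ z : Fin k → ℤ, D.P γ.log = fun i => (z i : ℝ)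
  exists_P_eq : ∀ z : Fin k → ℤ, ∃ γ ∈ Γ, D.P γ.log = fun i => (z i : ℝ)
  exp_ξ_mem_iff : ∀ s, exp (D.ξ s) ∈ Γ ↔ ∃ z : Fin m → ℤ, s = fun i => (z i : ℝ)

variable {D} {Γ : Subgroup (SimplyConnectedGroup 𝔤)}

namespace IsIntegral

/-- The projection of the nilmanifold to the base torus. -/
def proj (hD : D.IsIntegral Γ) : Space Γ → UnitAddTorus (Fin k) :=
  Quotient.lift (fun a => toTorus (D.P a.log)) fun a b hab => by
    obtain ⟨γ, hγ, rfl⟩ := mk_eq_mk_iff.1 (Quotient.sound hab)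
    obtain ⟨z, hz⟩ := hD.P_mem γ hγ
    rw [toTorus_eq_iff]
    exact ⟨z, by rw [D.P_log_mul, hz, add_comm]⟩

theorem proj_mk (hD : D.IsIntegral Γ) (a : SimplyConnectedGroup 𝔤) :
    hD.proj (Quotient.mk _ a) = toTorus (D.P a.log) := rfl

/-- Right translation by a central element. -/
def translate (D : CentralSplitting 𝔤 k m) (Γ : Subgroup (SimplyConnectedGroup 𝔤))
    (s : Fin m → ℝ) : Space Γ → Space Γ :=
  Quotient.map (fun a => a * exp (D.ξ s)) fun a b hab => by
    obtain ⟨γ, hγ, rfl⟩ := mk_eq_mk_iff.1 (Quotient.sound hab)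
    exact Quotient.exact (mk_eq_mk_iff.2 ⟨γ, hγ, mul_assoc _ _ _⟩)

/-- The action of the torus on the nilmanifold. -/
def act (D : CentralSplitting 𝔤 k m) (Γ : Subgroup (SimplyConnectedGroup 𝔤))
    (t : UnitAddTorus (Fin m)) : Space Γ → Space Γ :=
  translate D Γ (Function.surjInv toTorus_surjective t)

/-- Two real lifts of a torus element differ by an integral vector, whose exponential is central and
lies in `Γ`, so it is absorbed on the left. -/
theorem act_mk (hD : D.IsIntegral Γ) (s : Fin m → ℝ) (a : SimplyConnectedGroup 𝔤) :
    act D Γ (toTorus s) (Quotient.mk _ a) = Quotient.mk _ (a * exp (D.ξ s)) := by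
  obtain ⟨z, hz⟩ := toTorus_eq_iff.1 (Function.surjInv_eq toTorus_surjective (toTorus s))
  change Quotient.mk _ (a * exp (D.ξ (Function.surjInv toTorus_surjective (toTorus s)))) = _
  generalize Function.surjInv toTorus_surjective (toTorus s) = s' at hz
  refine mk_eq_mk_iff.2 ⟨exp (D.ξ fun i => (z i : ℝ)), (hD.exp_ξ_mem_iff _).2 ⟨z, rfl⟩, ?_⟩
  rw [D.exp_ξ_mul, D.mul_exp_ξ, D.mul_exp_ξ, hz, map_add, add_assoc]

/-- The trivializing coordinates, on the group. -/
theorem mk_eq_mk_iff_of_mem_ball (hD : D.IsIntegral Γ) {u₀ : Fin k → ℝ}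
    {a b : SimplyConnectedGroup 𝔤} (ha : D.P a.log ∈ Metric.ball u₀ (1 / 2))
    (hb : D.P b.log ∈ Metric.ball u₀ (1 / 2)) :
    (Quotient.mk _ a : Space Γ) = Quotient.mk _ b ↔
      (toTorus (D.P a.log), toTorus (D.ζ a.log)) = (toTorus (D.P b.log), toTorus (D.ζ b.log)) := by
  rw [mk_eq_mk_iff, Prod.mk.injEq]
  constructor
  · rintro ⟨γ, hγ, rfl⟩
    obtain ⟨z, hz⟩ := hD.P_mem γ hγ
    rw [D.P_log_mul, hz, add_comm] at hb
    -- An element of `Γ` that keeps a point over the small ball projects to `0`, so it is central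
    -- and merely translates the fibre coordinate `ζ` by an integral vector.
    have hz0 := int_eq_zero_of_mem_ball ha hb
    have hPγ : D.P γ.log = 0 := by
      rw [hz, hz0]
      simp
      rfl
    have hγξ : γ = exp (D.ξ (D.ζ γ.log)) := by
      ext
      exact D.eq_ξ_of_P_eq_zero hPγ
    rw [hγξ] at hγ
    obtain ⟨w, hw⟩ := (hD.exp_ξ_mem_iff _).1 hγ
    rw [hγξ, D.exp_ξ_mul, hw]
    refine ⟨by simp [D.P_ξ], toTorus_eq_iff.2 ⟨w, by simp [D.ζ_ξ]⟩⟩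
  · rintro ⟨h1, h2⟩
    obtain ⟨z, hz⟩ := toTorus_eq_iff.1 h1
    obtain ⟨w, hw⟩ := toTorus_eq_iff.1 h2
    rw [hz] at hb
    have hz0 := int_eq_zero_of_mem_ball ha hb
    refine ⟨exp (D.ξ fun i => (w i : ℝ)), (hD.exp_ξ_mem_iff _).2 ⟨w, rfl⟩, ?_⟩
    rw [D.exp_ξ_mul]
    ext
    have hP : D.P b.log = D.P a.log := by
      rw [hz, hz0]
      funext i
      simp
    rw [← D.σ_P_add_ξ_ζ b.log, ← D.σ_P_add_ξ_ζ a.log, hP, hw, map_add, add_assoc]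

/-- Over a ball of radius 1/2, the quotient map and `(P, ζ)` modulo integers are open maps that
identify the same points; the induced homeomorphism is the trivialization. It is equivariant because
right translation by `exp (ξ s)` shifts `ζ` by `s`. -/
theorem isPrincipalTorusBundle (hD : D.IsIntegral Γ) :
    IsPrincipalTorusBundle (act D Γ) hD.proj where
  zero_act p := by
    induction p using Quotient.inductionOn with | _ a
    rw [← toTorus_zero, hD.act_mk, D.mul_exp_ξ, map_zero, add_zero]
  add_act s t p := by
    induction p using Quotient.inductionOn with | _ a
    obtain ⟨s, rfl⟩ := toTorus_surjective s
    obtain ⟨t, rfl⟩ := toTorus_surjective t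
    rw [← toTorus_add, hD.act_mk, hD.act_mk, hD.act_mk, D.mul_exp_ξ, D.mul_exp_ξ, D.mul_exp_ξ,
      map_add, add_assoc, add_comm (D.ξ t)]
  proj_act s p := by
    induction p using Quotient.inductionOn with | _ a
    obtain ⟨s, rfl⟩ := toTorus_surjective s
    rw [hD.act_mk, hD.proj_mk, hD.proj_mk, D.mul_exp_ξ]
    simp [D.P_ξ]
  exists_trivialization b := by
    obtain ⟨u₀, rfl⟩ := toTorus_surjective b
    have hu₀ : u₀ ∈ Metric.ball u₀ (1 / 2) := Metric.mem_ball_self (by norm_num)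
    obtain ⟨W, hW⟩ : ∃ W : Set (SimplyConnectedGroup 𝔤),
      W = (fun a => D.P a.log) ⁻¹' Metric.ball u₀ (1 / 2) := ⟨_, rfl⟩
    have hWmem : ∀ a, a ∈ W ↔ D.P a.log ∈ Metric.ball u₀ (1 / 2) := fun a => by rw [hW]; rfl
    have hWo : IsOpen W := by
      rw [hW]
      exact Metric.isOpen_ball.preimage (continuous_linearMap_log D.P)
    obtain ⟨e, hsource, htarget, he⟩ := exists_openPartialHomeomorph_of_isOpenMap
      (continuous_space_mk Γ) (isOpenMap_space_mk Γ)
      (q := fun a : SimplyConnectedGroup 𝔤 => (toTorus (D.P a.log), toTorus (D.ζ a.log)))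
      ((continuous_toTorus.prodMap continuous_toTorus).comp D.homeomorph.continuous)
      ((isOpenMap_toTorus.prodMap isOpenMap_toTorus).comp D.homeomorph.isOpenMap) hWo
      ⟨exp (D.σ u₀), by rw [hWmem, D.P_σ]; exact hu₀⟩
      fun a ha b hb => hD.mk_eq_mk_iff_of_mem_ball ((hWmem a).1 ha) ((hWmem b).1 hb)
    refine ⟨{ e with
      baseSet := toTorus '' Metric.ball u₀ (1 / 2)
      open_baseSet := isOpenMap_toTorus _ Metric.isOpen_ball
      source_eq := ?_
      target_eq := ?_
      proj_toFun := ?_ }, ⟨u₀, hu₀, rfl⟩, ?_⟩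
    · rw [hsource]
      ext p
      induction p using Quotient.inductionOn with | _ a
      constructor
      · rintro ⟨b, hb, hba⟩
        rw [← hba]
        exact ⟨_, (hWmem b).1 hb, rfl⟩
      · rintro ⟨u, hu, hua⟩
        obtain ⟨z, hz⟩ := toTorus_eq_iff.1 hua
        -- Any point over the base set has a representative in `W`, obtained by cancelling the
        -- integral discrepancy with an element of `Γ`.
        obtain ⟨γ, hγ, hγz⟩ := hD.exists_P_eq (-z)
        refine ⟨γ * a, ?_, (mk_eq_mk_iff.2 ⟨γ, hγ, rfl⟩).symm⟩
        rw [hWmem, D.P_log_mul, hγz, hz]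
        convert hu using 1
        funext i
        simp
    · rw [htarget]
      ext ⟨x, y⟩
      constructor
      · rintro ⟨a, ha, hax⟩
        rw [Prod.mk.injEq] at hax
        exact ⟨⟨_, (hWmem a).1 ha, hax.1⟩, trivial⟩
      · rintro ⟨⟨u, hu, hux⟩, -⟩
        obtain ⟨s, rfl⟩ := toTorus_surjective y
        refine ⟨exp (D.σ u + D.ξ s), ?_, ?_⟩
        · rw [hWmem]
          simpa [D.P_σ, D.P_ξ] using hu
        · simpa [D.P_σ, D.P_ξ, D.ζ_σ, D.ζ_ξ] using hux
    · intro p hp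
      rw [hsource] at hp
      obtain ⟨a, ha, rfl⟩ := hp
      exact congrArg Prod.fst (he a ha)
    · intro s p hp
      obtain ⟨s, rfl⟩ := toTorus_surjective s
      change p ∈ e.source at hp
      rw [hsource] at hp
      obtain ⟨a, ha, rfl⟩ := hp
      change (e _).2 = _ + (e _).2
      rw [hD.act_mk, he a ha, he _ (by
        rw [hWmem, D.P_log_mul]
        simpa [D.P_ξ] using (hWmem a).1 ha), D.mul_exp_ξ, ← toTorus_add]
      simp [D.ζ_ξ, add_comm]

end IsIntegral
end CentralSplitting

/-! ### Lattices -/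

open Topology in
/-- A discrete subgroup of `ℝⁿ` on which no nonzero linear form vanishes is the image of `ℤⁿ` under
a linear automorphism. -/
theorem exists_linearEquiv_int {n : ℕ} (L : AddSubgroup (Fin n → ℝ)) {U : Set (Fin n → ℝ)}
    (hU : U ∈ 𝓝 0) (hdisc : ∀ x ∈ L, x ∈ U → x = 0)
    (hspan : ∀ f : (Fin n → ℝ) →ₗ[ℝ] ℝ, (∀ x ∈ L, f x = 0) → f = 0) :
    ∃ A : (Fin n → ℝ) ≃ₗ[ℝ] (Fin n → ℝ),
      ∀ x, x ∈ L ↔ ∃ z : Fin n → ℤ, A x = fun i => (z i : ℝ) := by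
  let L' : Submodule ℤ (Fin n → ℝ) := AddSubgroup.toIntSubmodule L
  have : DiscreteTopology L' := by
    refine discreteTopology_of_isOpen_singleton_zero (isOpen_iff_mem_nhds.2 ?_)
    rintro _ rfl
    rw [nhds_subtype]
    exact Filter.mem_of_superset (Filter.preimage_mem_comap hU) fun x hx =>
      Subtype.ext (hdisc x x.2 hx)
  -- A proper span would lie in the kernel of a nonzero linear form.
  have : IsZLattice ℝ L' := ⟨by
    by_contra hne
    obtain ⟨f, hf0, hf⟩ := Submodule.exists_le_ker_of_lt_top _ (lt_top_iff_ne_top.2 hne)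
    exact hf0 (hspan f fun x hx => hf (Submodule.subset_span hx))⟩
  let b := IsZLattice.basis L'
  refine ⟨(b.ofZLatticeBasis ℝ L').equivFun, fun x => ⟨fun hx => ?_, ?_⟩⟩
  · exact ⟨b.repr ⟨x, hx⟩, funext fun i => b.ofZLatticeBasis_repr_apply ℝ L' ⟨x, hx⟩ i⟩
  · rintro ⟨z, hz⟩
    have hx := (b.ofZLatticeBasis ℝ L').sum_equivFun x
    rw [hz] at hx
    change x ∈ L'
    rw [← hx]
    refine sum_mem fun i _ => ?_
    rw [Int.cast_smul_eq_zsmul, b.ofZLatticeBasis_apply ℝ L']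
    exact L'.smul_mem _ (b i).2

section

variable {𝔤 : Type*} [LieRing 𝔤] [LieAlgebra ℝ 𝔤] [IsTwoStepNilpotent 𝔤]
  {Γ : Subgroup (SimplyConnectedGroup 𝔤)}

/-- In step two, the group commutator is the exponential of the Lie bracket. -/
theorem exp_lie_mem {γ δ : SimplyConnectedGroup 𝔤} (hγ : γ ∈ Γ) (hδ : δ ∈ Γ) :
    exp ⁅γ.log, δ.log⁆ ∈ Γ := by
  have h : (exp ⁅γ.log, δ.log⁆ : SimplyConnectedGroup 𝔤) = γ * δ * (γ⁻¹ * δ⁻¹) := by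
    ext
    simp only [log_mul, log_inv, lie_add, add_lie, lie_neg, neg_lie, lie_smul, smul_lie,
      lie_lie_left_eq_zero, IsTwoStepNilpotent.lie_lie_eq_zero, lie_self, neg_neg,
      ← lie_skew γ.log δ.log]
    module
  rw [h]
  exact Γ.mul_mem (Γ.mul_mem hγ hδ) (Γ.mul_mem (Γ.inv_mem hγ) (Γ.inv_mem hδ))

/-- The image of `Γ` under the homomorphism to a vector space that is given by a linear map
vanishing on the brackets. -/
def imageSubgroup (Γ : Subgroup (SimplyConnectedGroup 𝔤)) {E : Type*} [AddCommGroup E]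
    [Module ℝ E] (f : 𝔤 →ₗ[ℝ] E) (hf : ∀ x y : 𝔤, f ⁅x, y⁆ = 0) : AddSubgroup E where
  carrier := {u | ∃ γ ∈ Γ, f γ.log = u}
  add_mem' := by
    rintro _ _ ⟨γ, hγ, rfl⟩ ⟨δ, hδ, rfl⟩
    exact ⟨γ * δ, Γ.mul_mem hγ hδ, by simp [hf]⟩
  zero_mem' := ⟨1, Γ.one_mem, by simp⟩
  neg_mem' := by
    rintro _ ⟨γ, hγ, rfl⟩
    exact ⟨γ⁻¹, Γ.inv_mem hγ, by simp⟩

open Topology in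
theorem IsLattice.exists_nhds (hΓ : IsLattice Γ) :
    ∃ U ∈ 𝓝 (1 : SimplyConnectedGroup 𝔤), ∀ γ ∈ Γ, γ ∈ U → γ = 1 := by
  have := hΓ.discrete
  have h : ({1} : Set Γ) ∈ 𝓝 (1 : Γ) := (isOpen_discrete _).mem_nhds rfl
  rw [nhds_subtype, Filter.mem_comap] at h
  obtain ⟨U, hU, hsub⟩ := h
  exact ⟨U, hU, fun γ hγ hγU => congrArg Subtype.val (@hsub ⟨γ, hγ⟩ hγU)⟩

/-- A homomorphism to `ℝ` that is trivial on a lattice is trivial. -/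
theorem IsLattice.linearMap_eq_zero (hΓ : IsLattice Γ) {f : 𝔤 →ₗ[ℝ] ℝ}
    (hlie : ∀ x y : 𝔤, f ⁅x, y⁆ = 0) (hf : ∀ γ ∈ Γ, f γ.log = 0) : f = 0 := by
  have := hΓ.cocompact
  let F : Space Γ → ℝ := Quotient.lift (fun a => f a.log) fun a b hab => by
    obtain ⟨γ, hγ, rfl⟩ := mk_eq_mk_iff.1 (Quotient.sound hab)
    simp [hlie, hf γ hγ]
  -- The form descends to a continuous function on a compact space, so it is bounded; a bounded
  -- linear form is zero.
  have hF : Continuous F := (continuous_linearMap_log f).quotient_lift _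
  obtain ⟨M, hM⟩ := (isCompact_range hF).bddAbove
  ext x
  by_contra hx
  have hx : f x ≠ 0 := hx
  have h := hM ⟨Quotient.mk _ (exp (((M + 1) / f x) • x)), rfl⟩
  have h' : f (((M + 1) / f x) • x) ≤ M := h
  rw [map_smul, smul_eq_mul, div_mul_cancel₀ _ hx] at h'
  linarith

namespace CentralSplitting

variable {k m : ℕ} (D : CentralSplitting 𝔤 k m)

/-- The image of `Γ` in `ℝᵏ`. -/
def baseLattice (Γ : Subgroup (SimplyConnectedGroup 𝔤)) : AddSubgroup (Fin k → ℝ) :=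
  imageSubgroup Γ D.P D.P_lie

/-- The intersection of `Γ` with the centre. -/
def fibreLattice (Γ : Subgroup (SimplyConnectedGroup 𝔤)) : AddSubgroup (Fin m → ℝ) where
  carrier := {s | exp (D.ξ s) ∈ Γ}
  add_mem' {s t} hs ht := by
    have h := Γ.mul_mem hs ht
    rw [D.mul_exp_ξ] at h
    simpa using h
  zero_mem' := by
    change exp (D.ξ 0) ∈ Γ
    rw [map_zero]
    exact Γ.one_mem
  neg_mem' {s} hs := by
    change exp (D.ξ (-s)) ∈ Γ
    rw [map_neg]
    exact Γ.inv_mem hs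

theorem P_log_mem {γ : SimplyConnectedGroup 𝔤} (hγ : γ ∈ Γ) : D.P γ.log ∈ D.baseLattice Γ :=
  ⟨γ, hγ, rfl⟩

theorem ζ_mem_fibreLattice {γ : SimplyConnectedGroup 𝔤} (hγ : γ ∈ Γ) (hP : D.P γ.log = 0) :
    D.ζ γ.log ∈ D.fibreLattice Γ := by
  change exp (D.ξ (D.ζ γ.log)) ∈ Γ
  rw [← D.eq_ξ_of_P_eq_zero hP]
  exact hγ

theorem eq_zero_of_baseLattice (hΓ : IsLattice Γ) {f : (Fin k → ℝ) →ₗ[ℝ] ℝ}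
    (hf : ∀ u ∈ D.baseLattice Γ, f u = 0) : f = 0 := by
  have h := hΓ.linearMap_eq_zero (f := f ∘ₗ D.P) (fun x y => by simp [D.P_lie])
    fun γ hγ => hf _ (D.P_log_mem hγ)
  refine LinearMap.ext fun u => ?_
  rw [← D.P_σ u]
  exact LinearMap.congr_fun h (D.σ u)

theorem span_baseLattice (hΓ : IsLattice Γ) :
    Submodule.span ℝ (D.baseLattice Γ : Set (Fin k → ℝ)) = ⊤ := by
  by_contra hne
  obtain ⟨f, hf0, hf⟩ := Submodule.exists_le_ker_of_lt_top _ (lt_top_iff_ne_top.2 hne)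
  exact hf0 (D.eq_zero_of_baseLattice hΓ fun x hx => hf (Submodule.subset_span hx))

-- Choose finitely many lattice elements whose projections form a basis. If `γ` projects close to
-- `0`, its brackets with them are small logarithms of elements of `Γ`, hence zero by discreteness;
-- then `γ.log` is central and projects to `0`.
open Topology in
theorem exists_nhds_baseLattice (hΓ : IsLattice Γ) :
    ∃ U ∈ 𝓝 (0 : Fin k → ℝ), ∀ u ∈ D.baseLattice Γ, u ∈ U → u = 0 := by
  obtain ⟨U, hU, hUΓ⟩ := hΓ.exists_nhds
  obtain ⟨b, hb, hspan, hli⟩ := exists_linearIndependent ℝ (D.baseLattice Γ : Set (Fin k → ℝ))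
  rw [D.span_baseLattice hΓ] at hspan
  have hbfin : b.Finite := hli.setFinite
  refine ⟨⋂ v ∈ b, {u | exp ⁅D.σ u, D.σ v⁆ ∈ U}, (Filter.biInter_mem hbfin).2 fun v _ => ?_, ?_⟩
  · let f : (Fin k → ℝ) →ₗ[ℝ] 𝔤 := -(LieAlgebra.ad ℝ 𝔤 (D.σ v) ∘ₗ D.σ)
    have hf : ∀ u, f u = ⁅D.σ u, D.σ v⁆ := fun u => by simp [f]
    have hcont := (continuous_exp_linearMap f).tendsto 0
    rw [map_zero] at hcont
    simp only [hf] at hcont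
    exact hcont hU
  · rintro _ ⟨γ, hγ, rfl⟩ hu
    refine D.P_eq_zero _ fun y => ?_
    have hker : (⊤ : Submodule ℝ (Fin k → ℝ)) ≤
        LinearMap.ker (LieAlgebra.ad ℝ 𝔤 γ.log ∘ₗ D.σ) := by
      rw [← hspan, Submodule.span_le]
      intro v hv
      obtain ⟨δ, hδ, hδv⟩ := hb hv
      have h1 : exp ⁅D.σ (D.P γ.log), D.σ v⁆ ∈ U := Set.mem_iInter₂.1 hu v hv
      rw [← hδv, D.lie_eq_lie_σ_left, D.lie_eq_lie_σ_right] at h1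
      have h2 := congrArg log (hUΓ _ (exp_lie_mem hγ hδ) h1)
      change ⁅γ.log, D.σ v⁆ = 0
      rw [← hδv, D.lie_eq_lie_σ_right]
      exact h2
    rw [← D.lie_eq_lie_σ_right]
    exact hker (Submodule.mem_top (x := D.P y))

open Topology in
theorem exists_nhds_fibreLattice (hΓ : IsLattice Γ) :
    ∃ U ∈ 𝓝 (0 : Fin m → ℝ), ∀ u ∈ D.fibreLattice Γ, u ∈ U → u = 0 := by
  obtain ⟨U, hU, hUΓ⟩ := hΓ.exists_nhds
  have hcont := (continuous_exp_linearMap D.ξ).tendsto 0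
  rw [map_zero] at hcont
  refine ⟨_, hcont hU, fun s hs hsU => ?_⟩
  have h := congrArg log (hUΓ _ hs hsU)
  rw [← D.ζ_ξ s]
  exact (congrArg D.ζ h).trans (map_zero _)

/-- For two elements of `Γ` the bracket lies in the fibre lattice. Since `Γ` spans modulo the
centre, the identity extends linearly, one argument at a time. -/
theorem ζ_lie_eq_zero (hΓ : IsLattice Γ) {f : (Fin m → ℝ) →ₗ[ℝ] ℝ}
    (hf : ∀ s ∈ D.fibreLattice Γ, f s = 0) (x y : 𝔤) : f (D.ζ ⁅x, y⁆) = 0 := by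
  have h1 : ∀ γ ∈ Γ, ∀ δ ∈ Γ, f (D.ζ ⁅γ.log, δ.log⁆) = 0 := fun γ hγ δ hδ =>
    hf _ (D.ζ_mem_fibreLattice (exp_lie_mem hγ hδ) (D.P_lie _ _))
  have h2 : ∀ γ ∈ Γ, ∀ y, f (D.ζ ⁅γ.log, y⁆) = 0 := fun γ hγ y => by
    have h := D.eq_zero_of_baseLattice hΓ
      (f := f ∘ₗ D.ζ ∘ₗ (LieAlgebra.ad ℝ 𝔤 γ.log) ∘ₗ D.σ) (by
        rintro _ ⟨δ, hδ, rfl⟩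
        simpa [D.lie_eq_lie_σ_right] using h1 γ hγ δ hδ)
    simpa [D.lie_eq_lie_σ_right] using LinearMap.congr_fun h (D.P y)
  have h := D.eq_zero_of_baseLattice hΓ
    (f := f ∘ₗ D.ζ ∘ₗ (LieAlgebra.ad ℝ 𝔤 y) ∘ₗ D.σ) (by
      rintro _ ⟨δ, hδ, rfl⟩
      have := h2 δ hδ y
      rw [← lie_skew, map_neg, map_neg, neg_eq_zero] at this
      simpa [D.lie_eq_lie_σ_right] using this)
  have h3 : f (D.ζ ⁅y, x⁆) = 0 := by
    simpa [D.lie_eq_lie_σ_right] using LinearMap.congr_fun h (D.P x)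
  rw [← lie_skew, map_neg, map_neg, h3, neg_zero]

/-- The form `F = f ∘ ζ` kills brackets, so it gives a homomorphism of the group to `ℝ`. On `Γ` it
depends only on the projection, which runs over a copy of `ℤᵏ`, so there it agrees with `μ ∘ P` for
a linear `μ`. The difference is trivial on the lattice, hence zero, and evaluation on the centre
gives `f = 0`. -/
theorem eq_zero_of_fibreLattice (hΓ : IsLattice Γ) {f : (Fin m → ℝ) →ₗ[ℝ] ℝ}
    (hf : ∀ s ∈ D.fibreLattice Γ, f s = 0) {A : (Fin k → ℝ) ≃ₗ[ℝ] (Fin k → ℝ)}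
    (hA : ∀ x, x ∈ D.baseLattice Γ ↔ ∃ z : Fin k → ℤ, A x = fun i => (z i : ℝ)) : f = 0 := by
  have hlie := D.ζ_lie_eq_zero hΓ hf
  obtain ⟨F, hF⟩ : ∃ F : 𝔤 →ₗ[ℝ] ℝ, F = f ∘ₗ D.ζ := ⟨_, rfl⟩
  have hFx : ∀ x, F x = f (D.ζ x) := fun x => by rw [hF]; rfl
  have hFlie : ∀ x y : 𝔤, F ⁅x, y⁆ = 0 := fun x y => by rw [hFx, hlie]
  have heq : ∀ γ ∈ Γ, ∀ δ ∈ Γ, D.P γ.log = D.P δ.log → F γ.log = F δ.log := by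
    intro γ hγ δ hδ hP
    have h := hf _ (D.ζ_mem_fibreLattice (Γ.mul_mem hγ (Γ.inv_mem hδ)) (by
      rw [D.P_log_mul, hP, log_inv, map_neg, add_neg_cancel]))
    rw [← hFx] at h
    simpa [hFlie, ← sub_eq_add_neg, sub_eq_zero] using h
  have hgen : ∀ i, ∃ γ ∈ Γ, A (D.P γ.log) = Pi.single i 1 := fun i => by
    obtain ⟨γ, hγ, h⟩ := (hA (A.symm (Pi.single i 1))).2 ⟨Pi.single i 1, by
      rw [A.apply_symm_apply]
      funext j
      by_cases hj : j = i
      · subst hj; simp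
      · simp [hj]⟩
    exact ⟨γ, hγ, by rw [h, A.apply_symm_apply]⟩
  choose g hg hgA using hgen
  obtain ⟨μ, hμ⟩ : ∃ μ : (Fin k → ℝ) →ₗ[ℝ] ℝ,
      μ = Fintype.linearCombination ℝ (fun i => F (g i).log) ∘ₗ A.toLinearMap := ⟨_, rfl⟩
  have hμx : ∀ u, μ u = ∑ i, A u i * F (g i).log := fun u => by
    simp [hμ, Fintype.linearCombination_apply]
  have hzero := hΓ.linearMap_eq_zero (f := F - μ ∘ₗ D.P)
    (fun x y => by simp [hFlie, D.P_lie]) (fun γ hγ => by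
      obtain ⟨z, hz⟩ := (hA _).1 (D.P_log_mem hγ)
      -- Working in the additive image of `Γ` under `(P, F)` produces an element `δ` without forming
      -- ordered products of powers of the generators.
      have hmem : ∑ i, z i • (D.P (g i).log, F (g i).log) ∈
          imageSubgroup Γ (D.P.prod F) (fun x y => by simp [D.P_lie, hFlie]) :=
        sum_mem fun i _ => AddSubgroup.zsmul_mem _ (show _ ∈ imageSubgroup Γ (D.P.prod F) _ from ⟨g i, hg i, rfl⟩) _
      obtain ⟨δ, hδ, hδe⟩ := hmem
      rw [Prod.ext_iff] at hδe
      simp only [LinearMap.prod_apply, Function.prod_apply, Prod.fst_sum, Prod.snd_sum, Prod.smul_fst,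
        Prod.smul_snd] at hδe
      have hP : D.P γ.log = D.P δ.log := by
        apply A.injective
        rw [hz, hδe.1, map_sum]
        simp only [map_zsmul, hgA]
        funext j
        simp [Finset.sum_apply, Pi.single_apply]
      rw [LinearMap.sub_apply, LinearMap.comp_apply, heq γ hγ δ hδ hP, hδe.2, hμx, hz]
      simp)
  refine LinearMap.ext fun s => ?_
  have h := LinearMap.congr_fun hzero (D.ξ s)
  rw [LinearMap.sub_apply, LinearMap.comp_apply, D.P_ξ, map_zero, hFx, D.ζ_ξ, sub_zero] at h
  exact h

theorem exists_isIntegral_change (hΓ : IsLattice Γ) : ∃ A C, (D.change A C).IsIntegral Γ := by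
  obtain ⟨U, hU, hUΓ⟩ := D.exists_nhds_baseLattice hΓ
  obtain ⟨A, hA⟩ := exists_linearEquiv_int (D.baseLattice Γ) hU hUΓ
    fun f hf => D.eq_zero_of_baseLattice hΓ hf
  obtain ⟨V, hV, hVΓ⟩ := D.exists_nhds_fibreLattice hΓ
  obtain ⟨C, hC⟩ := exists_linearEquiv_int (D.fibreLattice Γ) hV hVΓ
    fun f hf => D.eq_zero_of_fibreLattice hΓ hf hA
  refine ⟨A, C, fun γ hγ => (hA _).1 (D.P_log_mem hγ), fun z => ?_, fun s => ?_⟩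
  · obtain ⟨γ, hγ, h⟩ := (hA (A.symm fun i => (z i : ℝ))).2 ⟨z, A.apply_symm_apply _⟩
    exact ⟨γ, hγ, by change A (D.P γ.log) = _; rw [h, A.apply_symm_apply]⟩
  · have h := hC (C.symm s)
    rw [C.apply_symm_apply] at h
    exact h

end CentralSplitting

end

/-! ### The torus bundle of an Abelian balanced structure -/

namespace HermitianStructure.IsAdaptedTriple

variable {𝔤 : Type*} [LieRing 𝔤] [LieAlgebra ℝ 𝔤] {S : HermitianStructure 𝔤} {a b c : 𝔤}

/-- The splitting of `𝔤` into the centre and its orthogonal complement, in unitary coordinates. -/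
def splitting (h : S.IsAdaptedTriple a b c) (hdim : Module.finrank ℝ 𝔤 = 6) :
    CentralSplitting 𝔤 4 2 where
  P := LinearMap.pi ![S.g a, S.g (S.J a), S.g b, S.g (S.J b)]
  σ := Fintype.linearCombination ℝ ![a, S.J a, b, S.J b]
  ξ := Fintype.linearCombination ℝ ![c, S.J c]
  ζ := LinearMap.pi ![S.g c, S.g (S.J c)]
  P_σ u := by
    have o := h.orthonormal
    funext i
    have o0 := o (i.castLE (by omega)) 0
    have o1 := o (i.castLE (by omega)) 1
    have o2 := o (i.castLE (by omega)) 2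
    have o3 := o (i.castLE (by omega)) 3
    fin_cases i <;> simp at o0 o1 o2 o3 <;>
      simp [Fintype.linearCombination_apply, Fin.sum_univ_four, o0, o1, o2, o3]
  P_ξ s := by
    have o := h.orthonormal
    funext i
    have o0 := o (i.castLE (by omega)) 4
    have o1 := o (i.castLE (by omega)) 5
    fin_cases i <;> simp at o0 o1 <;> simp [Fintype.linearCombination_apply, o0, o1]
  ζ_σ u := by
    funext i
    fin_cases i <;> simp [Fintype.linearCombination_apply, Fin.sum_univ_four, h.ca, h.cb, h.g_J_eq,
      h.Jca, h.Jcb, S.g_J]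
  ζ_ξ s := by
    funext i
    fin_cases i <;> simp [Fintype.linearCombination_apply, h.cc, S.g_self_J, S.g_J,
      S.g_symm (S.J c) c]
  σ_P_add_ξ_ζ x := by
    conv_rhs => rw [h.eq_sum hdim x]
    simp [Fintype.linearCombination_apply, Fin.sum_univ_four, add_assoc]
  ξ_lie s y := by
    simp [Fintype.linearCombination_apply, h.lie_c, h.lie_Jc]
  P_lie x y := by
    have o := h.orthonormal
    rw [h.lie_eq]
    funext i
    have o0 := o (i.castLE (by omega)) 4
    have o1 := o (i.castLE (by omega)) 5
    fin_cases i <;> simp at o0 o1 <;> simp [o0, o1]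
  P_eq_zero x hx := by
    have o := h.orthonormal
    rw [h.eq_of_central x hx]
    funext i
    have o0 := o (i.castLE (by omega)) 4
    have o1 := o (i.castLE (by omega)) 5
    fin_cases i <;> simp at o0 o1 <;> simp [o0, o1]

theorem g_splitting_σ (h : S.IsAdaptedTriple a b c) (hdim : Module.finrank ℝ 𝔤 = 6)
    (u : Fin 4 → ℝ) :
    S.g c ((h.splitting hdim).σ u) = 0 ∧ S.g (S.J c) ((h.splitting hdim).σ u) = 0 :=
  ⟨congrFun ((h.splitting hdim).ζ_σ u) 0, congrFun ((h.splitting hdim).ζ_σ u) 1⟩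

/-! ### The bundle from any splitting with horizontal space orthogonal to the centre, a condition
kept by `change` -/

section Splitting

variable {D : CentralSplitting 𝔤 4 2}

theorem σ_P_eq (h : S.IsAdaptedTriple a b c)
    (hσ : ∀ u, S.g c (D.σ u) = 0 ∧ S.g (S.J c) (D.σ u) = 0) (x : 𝔤) :
    x = D.σ (D.P x) + (S.g c x • c + S.g (S.J c) x • S.J c) := by
  have h1 := D.σ_P_add_ξ_ζ x
  have h2 : ∀ z, S.g z x = S.g z (D.σ (D.P x)) + S.g z (D.ξ (D.ζ x)) := fun z => by
    rw [← map_add, h1]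
  rw [h2 c, h2 (S.J c), (hσ _).1, (hσ _).2, zero_add, zero_add,
    ← h.eq_of_central _ (D.ξ_lie (D.ζ x)), h1]

theorem σ_P_J_σ (h : S.IsAdaptedTriple a b c)
    (hσ : ∀ u, S.g c (D.σ u) = 0 ∧ S.g (S.J c) (D.σ u) = 0) (u : Fin 4 → ℝ) :
    D.σ (D.P (S.J (D.σ u))) = S.J (D.σ u) := by
  have := h.σ_P_eq hσ (S.J (D.σ u))
  rw [S.g_J, S.g_J_right, (hσ u).1, (hσ u).2, neg_zero, zero_smul, zero_smul, add_zero,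
    add_zero] at this
  exact this.symm

/-- The Hermitian structure of the base. -/
def baseStructure (h : S.IsAdaptedTriple a b c)
    (hσ : ∀ u, S.g c (D.σ u) = 0 ∧ S.g (S.J c) (D.σ u) = 0) :
    HermitianStructure (Fin 4 → ℝ) where
  g := S.g.compl₁₂ D.σ D.σ
  J := D.P ∘ₗ S.J ∘ₗ D.σ
  g_symm u v := S.g_symm _ _
  g_pos u hu := S.g_pos _ fun h0 => hu (by rw [← D.P_σ u, h0, map_zero])
  J_sq u := by simp [h.σ_P_J_σ hσ, S.J_sq, D.P_σ]
  g_J u v := by simp [h.σ_P_J_σ hσ, S.g_J]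

theorem baseStructure_F (h : S.IsAdaptedTriple a b c)
    (hσ : ∀ u, S.g c (D.σ u) = 0 ∧ S.g (S.J c) (D.σ u) = 0) (u v : Fin 4 → ℝ) :
    (h.baseStructure hσ).F u v = S.F (D.σ u) (D.σ v) := by
  rw [F_apply, F_apply, ← h.σ_P_J_σ hσ v]
  rfl

/-- The curvature of the component `θ` of the connection. -/
def curvature (D : CentralSplitting 𝔤 4 2) (θ : 𝔤 →ₗ[ℝ] ℝ) :
    LinearMap.BilinForm ℝ (Fin 4 → ℝ) :=
  LinearMap.mk₂ ℝ (fun u v => -θ ⁅D.σ u, D.σ v⁆)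
    (fun u v w => by simp; ring) (fun r u v => by simp) (fun u v w => by simp; ring)
    (fun r u v => by simp)

theorem curvature_apply (θ : 𝔤 →ₗ[ℝ] ℝ) (u v : Fin 4 → ℝ) :
    curvature D θ u v = -θ ⁅D.σ u, D.σ v⁆ := rfl

/-- Type (1,1) comes from the Abelian condition, primitivity from the balanced one. -/
theorem isAntiSelfDual_curvature (h : S.IsAdaptedTriple a b c) (hab : S.IsAbelian)
    (hF : S.IsBalanced) (hσ : ∀ u, S.g c (D.σ u) = 0 ∧ S.g (S.J c) (D.σ u) = 0)
    (θ : 𝔤 →ₗ[ℝ] ℝ) : (h.baseStructure hσ).IsAntiSelfDual (curvature D θ) := by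
  have halt : (curvature D θ).IsAlt := fun u => by rw [curvature_apply, lie_self]; simp
  refine isAntiSelfDual_of_primitive _ (by simp) halt (fun u v => ?_) ?_
  · rw [curvature_apply, curvature_apply, ← hab (D.σ u), ← h.σ_P_J_σ hσ u, ← h.σ_P_J_σ hσ v]
    rfl
  · funext f
    rw [wedge_two_two halt (h.baseStructure hσ).F_isAlt]
    simp only [curvature_apply, h.baseStructure_F hσ, Pi.zero_apply]
    have key := congrArg θ (h.sum_lie_eq_zero hF (f := fun i => D.σ (f i))
      (fun i => (hσ _).1) (fun i => (hσ _).2))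
    simp only [map_add, map_sub, map_smul, smul_eq_mul, map_zero] at key
    linarith

theorem bijective_g_ξ (h : S.IsAdaptedTriple a b c) : Function.Bijective
    fun (s : Fin 2 → ℝ) (i : Fin 2) => (![S.g (S.J c), S.g c] i) (D.ξ s) := by
  let f : (Fin 2 → ℝ) →ₗ[ℝ] Fin 2 → ℝ := LinearMap.pi ![S.g (S.J c), S.g c] ∘ₗ D.ξ
  have hinj : Function.Injective f := by
    refine (injective_iff_map_eq_zero f).2 fun s hs => ?_
    have h0 : S.g (S.J c) (D.ξ s) = 0 := congrFun hs 0
    have h1 : S.g c (D.ξ s) = 0 := congrFun hs 1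
    rw [← D.ζ_ξ s, h.eq_of_central _ (D.ξ_lie s), h0, h1]
    simp
  exact ⟨hinj, LinearMap.injective_iff_surjective.1 hinj⟩

/-- The torus bundle. -/
def torusBundle [IsTwoStepNilpotent 𝔤] {Γ : Subgroup (SimplyConnectedGroup 𝔤)}
    (h : S.IsAdaptedTriple a b c) (hab : S.IsAbelian) (hF : S.IsBalanced)
    (hσ : ∀ u, S.g c (D.σ u) = 0 ∧ S.g (S.J c) (D.σ u) = 0) (hD : D.IsIntegral Γ) :
    AntiSelfDualTorusBundle Γ S where
  π := hD.proj
  act := CentralSplitting.IsIntegral.act D Γ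
  isPrincipal := hD.isPrincipalTorusBundle
  P := D.P
  P_lie := D.P_lie
  π_mk x := rfl
  ξ := D.ξ
  act_mk := hD.act_mk
  base := h.baseStructure hσ
  -- The order matters: `F(x, y) = g(x, J y)` gives `F (J c) c = 1`, so the form dual to `J c` comes
  -- first.
  η := ![S.g (S.J c), S.g c]
  η_ξ := h.bijective_g_ξ
  g_eq x y := by
    change _ = S.g (D.σ (D.P x)) (D.σ (D.P y)) + S.g (S.J c) x * S.g (S.J c) y + S.g c x * S.g c y
    conv_lhs => rw [h.σ_P_eq hσ x, h.σ_P_eq hσ y]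
    have k1 : ∀ u, S.g (D.σ u) c = 0 := fun u => by rw [S.g_symm, (hσ u).1]
    have k2 : ∀ u, S.g (D.σ u) (S.J c) = 0 := fun u => by rw [S.g_symm, (hσ u).2]
    simp [hσ, k1, k2, S.g_symm (S.J c) c, S.g_J, S.g_self_J, h.cc]
    ring
  F_eq x y := by
    rw [h.baseStructure_F hσ]
    change _ = _ + (S.g (S.J c) x * S.g c y - S.g c x * S.g (S.J c) y)
    conv_lhs => rw [h.σ_P_eq hσ x, h.σ_P_eq hσ y]
    have h1 : ∀ u, S.g c (S.J (D.σ u)) = 0 := fun u => by rw [S.g_J_right, (hσ u).2, neg_zero]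
    have k1 : ∀ u, S.g (D.σ u) c = 0 := fun u => by rw [S.g_symm, (hσ u).1]
    have k2 : ∀ u, S.g (D.σ u) (S.J c) = 0 := fun u => by rw [S.g_symm, (hσ u).2]
    simp [F_apply, hσ, h1, k1, k2, S.J_sq, S.g_symm (S.J c) c, S.g_J, S.g_self_J, h.cc]
    ring
  Ω i := curvature D (![S.g (S.J c), S.g c] i)
  dη_eq i x y := by
    rw [curvature_apply, D.lie_eq_lie_σ_left, D.lie_eq_lie_σ_right]
    rfl
  antiSelfDual i := h.isAntiSelfDual_curvature hab hF hσ _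

end Splitting

end HermitianStructure.IsAdaptedTriple

theorem nonempty_antiSelfDualTorusBundle {𝔤 : Type*} [LieRing 𝔤] [LieAlgebra ℝ 𝔤]
    [IsTwoStepNilpotent 𝔤] (hdim : Module.finrank ℝ 𝔤 = 6)
    {Γ : Subgroup (SimplyConnectedGroup 𝔤)} (hΓ : IsLattice Γ) {S : HermitianStructure 𝔤}
    (hF : S.IsBalanced) (hab : S.IsAbelian) : Nonempty (AntiSelfDualTorusBundle Γ S) := by
  obtain ⟨a, b, c, h⟩ := HermitianStructure.exists_isAdaptedTriple hdim hab hF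
  obtain ⟨A, C, hD⟩ := (h.splitting hdim).exists_isIntegral_change hΓ
  exact ⟨h.torusBundle hab hF (fun u => h.g_splitting_σ hdim (A.symm u)) hD⟩

end Nilmanifold

end

theorem mainTheorem6 {𝔤 : Type*} [LieRing 𝔤] [LieAlgebra ℝ 𝔤]
    [Nilmanifold.IsTwoStepNilpotent 𝔤] (hdim : Module.finrank ℝ 𝔤 = 6)
    (Γ : Subgroup (Nilmanifold.SimplyConnectedGroup 𝔤)) (hΓ : Nilmanifold.IsLattice Γ)
    (S : Nilmanifold.HermitianStructure 𝔤) (hJ : S.IsIntegrable) (hF : S.IsBalanced) :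
    (Nonempty (Nilmanifold.AntiSelfDualTorusBundle Γ S) ↔ S.IsAbelian) ∧
      (S.IsAbelian → Nonempty (𝔤 ≃ₗ⁅ℝ⁆ Nilmanifold.H3) ∨ Nonempty (𝔤 ≃ₗ⁅ℝ⁆ Nilmanifold.H5)) := by
  refine ⟨⟨fun ⟨T⟩ => T.isAbelian hdim,
    Nilmanifold.nonempty_antiSelfDualTorusBundle hdim hΓ hF⟩, fun hab => ?_⟩
  obtain ⟨a, b, c, h⟩ := Nilmanifold.HermitianStructure.exists_isAdaptedTriple hdim hab hF
  exact h.nonempty_lieEquiv hdim hab hF
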